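/- Let $\mathbb{K}$ be a field and let $(\Omega,\rightarrow)$ be a finite nonempty (associative) semigroup, of cardinality $\omega$. Let $\mathbf{As}_\Omega^2$ be the nonsymmetric operad over $\mathbb{K}$ generated by binary operations $*_{\alpha,\beta}$, $\alpha,\beta\in\Omega$, with the quadratic relations $$*_{\alpha\rightarrow\beta,\gamma}\circ_1 *_{\alpha,\beta}=*_{\alpha,\beta\rightarrow\gamma}\circ_2 *_{\beta,\gamma}\qquad(\alpha,\beta,\gamma\in\Omega),$$ and let $(\mathbf{As}_\Omega^2)^!$ be its Koszul dual, that is, the quotient of the free nonsymmetric operad on the dual space of the space of generators by the operadic ideal generated by the orthogonal of the space of relations, for the pairing on arity $3$ given by $\langle f\circ_1 g,a\circ_1 b\rangle=f(a)g(b)$, $\langle f\circ_2 g,a\circ_2 b\rangle=-f(a)g(b)$, $\langle f\circ_1 g,a\circ_2 b\rangle=\langle f\circ_2 g,a\circ_1 b\rangle=0$. For any $n\geqslant 1$, put $\mathbf{P}(n)=(\mathbb{K}\Omega)^{\otimes n}$, the vector space with basis the words $\alpha_1\ldots\alpha_n$ of length $n$ in $\Omega$. Then $\mathbf{P}=(\mathbf{P}(n))_{n\geqslant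 1}$ is a nonsymmetric operad for the multilinear composition given on words by $$\alpha_1\ldots \alpha_n \circ (\beta_{1,1}\ldots \beta_{1,k_1},\ldots,\beta_{n,1}\ldots \beta_{n,k_n}) =\left(\prod_{i=1}^n \delta_{\alpha_i,\, \beta_{i,1}\rightarrow \cdots\rightarrow \beta_{i,k_i}}\right) \beta_{1,1}\ldots \beta_{1,k_1}\ldots \beta_{n,1}\ldots \beta_{n,k_n},$$ with unit $I=\sum_{\alpha\in\Omega}\alpha\in\mathbf{P}(1)$. The subspaces $\mathbf{P}_0(1)=\mathbb{K}I$ and $\mathbf{P}_0(n)=\mathbf{P}(n)$ for $n\geqslant 2$ form a suboperad $\mathbf{P}_0$ of $\mathbf{P}$, and $\mathbf{P}_0$ is isomorphic, as a nonsymmetric operad, to $(\mathbf{As}_\Omega^2)^!$. In particular, $\dim_{\mathbb{K}}(\mathbf{As}_\Omega^2)^!(1)=1$ and $\dim_{\mathbb{K}}(\mathbf{As}_\Omega^2)^!(n)=\omega^n$ for all $n\geqslant 2$. -/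

import Mathlib

universe u v w

noncomputable section

/-! ### Nonsymmetric operads -/

/-- The data of a nonsymmetric operad in `K`-vector spaces: components `obj n` (arity `n`), a unit
`one` in arity `1`, and the total compositions `a ∘ (b₁, …, bₙ)`, linear in each argument.
Operads `(P(n))_{n ≥ 1}` without component of arity `0` are those with `obj 0 = 0`. -/
structure OperadData (K : Type u) [Field K] where
  obj : ℕ → Type w
  [instAddCommGroup : ∀ n, AddCommGroup (obj n)]
  [instModule : ∀ n, Module K (obj n)]
  one : obj 1
  comp : ∀ {n : ℕ} (k : Fin n → ℕ),
    obj n →ₗ[K] MultilinearMap K (fun i => obj (k i)) (obj (∑ i, k i))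

attribute [instance] OperadData.instAddCommGroup OperadData.instModule

/-- The axioms of a nonsymmetric operad. The two sides of each axiom live in components whose
arities are equal, but not by definition; the equalities are therefore written in `Σ n, O.obj n`
(they say that the arities agree and that the elements agree). In `assoc`, the leaves of
`a ∘ (b₁, …, bₙ)` are numbered from left to right: `finSigmaFinEquiv` is the
lexicographic bijection `{(i, j)} ≃ {0, …, k₁ + ⋯ + kₙ - 1}`. -/
structure OperadData.IsOperad {K : Type u} [Field K] (O : OperadData.{u, w} K) : Prop where
  one_comp : ∀ {n : ℕ} (a : O.obj n),
    (⟨_, O.comp (fun _ : Fin 1 => n) O.one (fun _ => a)⟩ : Σ m, O.obj m) = ⟨n, a⟩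
  comp_one : ∀ {n : ℕ} (a : O.obj n),
    (⟨_, O.comp (fun _ : Fin n => 1) a (fun _ => O.one)⟩ : Σ m, O.obj m) = ⟨n, a⟩
  assoc : ∀ {n : ℕ} (k : Fin n → ℕ) (l : (Σ i, Fin (k i)) → ℕ)
    (a : O.obj n) (b : ∀ i, O.obj (k i)) (c : ∀ p, O.obj (l p)),
    (⟨_, O.comp (fun m => l (finSigmaFinEquiv.symm m)) (O.comp k a b)
        (fun m => c (finSigmaFinEquiv.symm m))⟩ : Σ m, O.obj m) =
      ⟨_, O.comp (fun i => ∑ j, l ⟨i, j⟩) a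
        (fun i => O.comp (fun j => l ⟨i, j⟩) (b i) (fun j => c ⟨i, j⟩))⟩

/-- Nonsymmetric operads over `K`. -/
structure NSOperad (K : Type u) [Field K] extends OperadData.{u, w} K where
  isOperad : toOperadData.IsOperad

/-- Isomorphisms of nonsymmetric operads. -/
structure NSOperad.Iso {K : Type u} [Field K] (O : NSOperad.{u, v} K) (O' : NSOperad.{u, w} K) where
  equiv : ∀ n, O.obj n ≃ₗ[K] O'.obj n
  map_one : equiv 1 O.one = O'.one
  map_comp : ∀ {n : ℕ} (k : Fin n → ℕ) (a : O.obj n) (b : ∀ i, O.obj (k i)),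
    equiv _ (O.comp k a b) = O'.comp k (equiv n a) (fun i => equiv (k i) (b i))

/-! ### Suboperads -/

/-- Families of subspaces containing the unit and stable under composition. -/
structure NSOperad.Suboperad {K : Type u} [Field K] (O : NSOperad.{u, w} K) where
  carrier : ∀ n, Submodule K (O.obj n)
  one_mem : O.one ∈ carrier 1
  comp_mem : ∀ {n : ℕ} (k : Fin n → ℕ) (a : O.obj n) (b : ∀ i, O.obj (k i)),
    a ∈ carrier n → (∀ i, b i ∈ carrier (k i)) → O.comp k a b ∈ carrier (∑ i, k i)

theorem sigma_mk_eq_of_val {K : Type u} [Field K] {O : OperadData.{u, w} K}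
    {S : ∀ n, Submodule K (O.obj n)} {m n : ℕ} {x : S m} {y : S n}
    (h : (⟨m, x.1⟩ : Σ n, O.obj n) = ⟨n, y.1⟩) :
    (⟨m, x⟩ : Σ n, S n) = ⟨n, y⟩ := by
  obtain ⟨x, hx⟩ := x
  obtain ⟨y, hy⟩ := y
  simp only [Sigma.mk.injEq] at h
  obtain ⟨rfl, h⟩ := h
  obtain rfl := eq_of_heq h
  rfl

/-- A suboperad, as an operad with the restricted unit and composition. -/
def NSOperad.Suboperad.toNSOperad {K : Type u} [Field K] {O : NSOperad.{u, w} K}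
    (S : O.Suboperad) : NSOperad.{u, w} K where
  obj n := S.carrier n
  one := ⟨O.one, S.one_mem⟩
  comp {n} k :=
    { toFun := fun a =>
        ((O.comp k a.1).compLinearMap (fun i => (S.carrier (k i)).subtype)).codRestrict
          (S.carrier (∑ i, k i)) (fun b => S.comp_mem k a.1 _ a.2 (fun i => (b i).2))
      map_add' := fun a a' => by
        ext b
        exact congrArg (fun f : MultilinearMap K _ _ => f (fun i => (b i).1))
          ((O.comp k).map_add a.1 a'.1)
      map_smul' := fun r a => by
        ext b
        exact congrArg (fun f : MultilinearMap K _ _ => f (fun i => (b i).1))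
          ((O.comp k).map_smul r a.1) }
  isOperad :=
    { one_comp := fun a => sigma_mk_eq_of_val (O.isOperad.one_comp a.1)
      comp_one := fun a => sigma_mk_eq_of_val (O.isOperad.comp_one a.1)
      assoc := fun k l a b c =>
        sigma_mk_eq_of_val (O.isOperad.assoc k l a.1 (fun i => (b i).1) (fun p => (c p).1)) }

/-! ### Operadic ideals and quotients -/

/-- Operadic ideals: a composition lies in the ideal as soon as one of the composed elements
does. -/
structure NSOperad.OperadIdeal {K : Type u} [Field K] (O : NSOperad.{u, w} K) where
  carrier : ∀ n, Submodule K (O.obj n)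
  comp_left : ∀ {n : ℕ} (k : Fin n → ℕ) (a : O.obj n) (b : ∀ i, O.obj (k i)),
    a ∈ carrier n → O.comp k a b ∈ carrier (∑ i, k i)
  comp_right : ∀ {n : ℕ} (k : Fin n → ℕ) (a : O.obj n) (b : ∀ i, O.obj (k i)) (i : Fin n),
    b i ∈ carrier (k i) → O.comp k a b ∈ carrier (∑ i, k i)

/-- The operadic ideal generated by a set of elements of arity `m`: the intersection of all the
operadic ideals which contain it. -/
def NSOperad.idealSpan {K : Type u} [Field K] (O : NSOperad.{u, w} K) {m : ℕ}
    (R : Set (O.obj m)) : O.OperadIdeal where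
  carrier n := ⨅ J : {J : O.OperadIdeal // R ⊆ J.carrier m}, J.1.carrier n
  comp_left k a b ha := by
    rw [Submodule.mem_iInf] at ha ⊢
    exact fun J => J.1.comp_left k a b (ha J)
  comp_right k a b i hb := by
    rw [Submodule.mem_iInf] at hb ⊢
    exact fun J => J.1.comp_right k a b i (hb J)

theorem NSOperad.OperadIdeal.comp_sub_mem {K : Type u} [Field K] {O : NSOperad.{u, w} K}
    (J : O.OperadIdeal) {n : ℕ} (k : Fin n → ℕ) (a : O.obj n) (b b' : ∀ i, O.obj (k i))
    (h : ∀ i, b i - b' i ∈ J.carrier (k i)) :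
    O.comp k a b - O.comp k a b' ∈ J.carrier (∑ i, k i) := by
  classical
  have key : ∀ s : Finset (Fin n),
      O.comp k a (s.piecewise b b') - O.comp k a b' ∈ J.carrier (∑ i, k i) := by
    intro s
    induction s using Finset.induction_on with
    | empty => simp
    | insert i s hi ih =>
      have e : O.comp k a ((insert i s).piecewise b b') - O.comp k a (s.piecewise b b') =
          O.comp k a (Function.update (s.piecewise b b') i (b i - b' i)) := by
        rw [MultilinearMap.map_update_sub, Finset.piecewise_insert]
        congr 2
        rw [eq_comm, Function.update_eq_self_iff]
        simp [hi]
      have := J.comp_right k a (Function.update (s.piecewise b b') i (b i - b' i)) i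
        (by simpa using h i)
      rw [← e] at this
      have := add_mem this ih
      simpa using this
  simpa using key Finset.univ

theorem NSOperad.OperadIdeal.mkQ_comp_congr {K : Type u} [Field K] {O : NSOperad.{u, w} K}
    (J : O.OperadIdeal) {n : ℕ} (k : Fin n → ℕ) (a : O.obj n) (b b' : ∀ i, O.obj (k i))
    (h : ∀ i, (J.carrier (k i)).mkQ (b i) = (J.carrier (k i)).mkQ (b' i)) :
    (J.carrier (∑ i, k i)).mkQ (O.comp k a b) = (J.carrier (∑ i, k i)).mkQ (O.comp k a b') := by
  simp only [Submodule.mkQ_apply, Submodule.Quotient.eq] at h ⊢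
  exact J.comp_sub_mem k a b b' h

/-- The composition of the quotient operad, on an element `a` of the operad and on classes. -/
def NSOperad.OperadIdeal.quotCompAux {K : Type u} [Field K] {O : NSOperad.{u, w} K}
    (J : O.OperadIdeal) {n : ℕ} (k : Fin n → ℕ) (a : O.obj n) :
    MultilinearMap K (fun i => O.obj (k i) ⧸ J.carrier (k i))
      (O.obj (∑ i, k i) ⧸ J.carrier (∑ i, k i)) where
  toFun b := (J.carrier (∑ i, k i)).mkQ (O.comp k a (fun i => Quotient.out (b i)))
  map_update_add' {dec} b i x y := by
    rw [Subsingleton.elim dec inferInstance]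
    have aux : ∀ z, (J.carrier (∑ i, k i)).mkQ
        (O.comp k a (fun j => Quotient.out (Function.update b i z j))) =
        (J.carrier (∑ i, k i)).mkQ (O.comp k a
          (Function.update (fun j => Quotient.out (b j)) i (Quotient.out z))) := by
      intro z
      congr 2
      funext j
      exact Function.apply_update (fun j (q : O.obj (k j) ⧸ J.carrier (k j)) => Quotient.out q)
        b i z j
    rw [aux, aux, aux, ← map_add, ← MultilinearMap.map_update_add]
    refine J.mkQ_comp_congr k a _ _ (fun j => ?_)
    by_cases hj : j = i
    · subst hj
      simp only [Function.update_self, map_add]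
      simp only [Submodule.mkQ_apply]
      exact (Quotient.out_eq (x + y)).trans
        (congrArg₂ (· + ·) (Quotient.out_eq x).symm (Quotient.out_eq y).symm)
    · simp [hj]
  map_update_smul' {dec} b i r x := by
    rw [Subsingleton.elim dec inferInstance]
    have aux : ∀ z, (J.carrier (∑ i, k i)).mkQ
        (O.comp k a (fun j => Quotient.out (Function.update b i z j))) =
        (J.carrier (∑ i, k i)).mkQ (O.comp k a
          (Function.update (fun j => Quotient.out (b j)) i (Quotient.out z))) := by
      intro z
      congr 2
      funext j
      exact Function.apply_update (fun j (q : O.obj (k j) ⧸ J.carrier (k j)) => Quotient.out q)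
        b i z j
    rw [aux, aux, ← map_smul, ← MultilinearMap.map_update_smul]
    refine J.mkQ_comp_congr k a _ _ (fun j => ?_)
    by_cases hj : j = i
    · subst hj
      simp only [Function.update_self, map_smul]
      simp only [Submodule.mkQ_apply]
      exact (Quotient.out_eq (r • x)).trans (congrArg (r • ·) (Quotient.out_eq x).symm)
    · simp [hj]

theorem NSOperad.OperadIdeal.quotCompAux_mk {K : Type u} [Field K] {O : NSOperad.{u, w} K}
    (J : O.OperadIdeal) {n : ℕ} (k : Fin n → ℕ) (a : O.obj n) (b : ∀ i, O.obj (k i)) :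
    J.quotCompAux k a (fun i => (J.carrier (k i)).mkQ (b i)) =
      (J.carrier (∑ i, k i)).mkQ (O.comp k a b) :=
  J.mkQ_comp_congr k a _ _ (fun i => Quotient.out_eq ((J.carrier (k i)).mkQ (b i)))

/-- Unit and composition of the quotient operad. -/
def NSOperad.OperadIdeal.quotientData {K : Type u} [Field K] {O : NSOperad.{u, w} K}
    (J : O.OperadIdeal) : OperadData.{u, w} K where
  obj n := O.obj n ⧸ J.carrier n
  one := (J.carrier 1).mkQ O.one
  comp {n} k := (J.carrier n).liftQ
    { toFun := J.quotCompAux k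
      map_add' := fun a a' => by ext b; simp [quotCompAux]
      map_smul' := fun r a => by ext b; simp [quotCompAux] }
    (fun a ha => by
      rw [LinearMap.mem_ker]
      ext b
      exact (Submodule.Quotient.mk_eq_zero _).2 (J.comp_left k a _ ha))

/-- The composition of the quotient operad is induced by the composition of the operad. -/
theorem NSOperad.OperadIdeal.quotientData_comp_mk {K : Type u} [Field K] {O : NSOperad.{u, w} K}
    (J : O.OperadIdeal) {n : ℕ} (k : Fin n → ℕ) (a : O.obj n) (b : ∀ i, O.obj (k i)) :
    J.quotientData.comp k ((J.carrier n).mkQ a) (fun i => (J.carrier (k i)).mkQ (b i)) =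
      (J.carrier (∑ i, k i)).mkQ (O.comp k a b) :=
  J.quotCompAux_mk k a b

theorem sigma_mk_mkQ {K : Type u} [Field K] {O : OperadData.{u, w} K}
    (S : ∀ n, Submodule K (O.obj n)) {m n : ℕ} {x : O.obj m} {y : O.obj n}
    (h : (⟨m, x⟩ : Σ n, O.obj n) = ⟨n, y⟩) :
    (⟨m, (S m).mkQ x⟩ : Σ n, O.obj n ⧸ S n) = ⟨n, (S n).mkQ y⟩ := by
  simp only [Sigma.mk.injEq] at h
  obtain ⟨rfl, h⟩ := h
  obtain rfl := eq_of_heq h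
  rfl

/-- The quotient of an operad by an operadic ideal. -/
def NSOperad.OperadIdeal.quotient {K : Type u} [Field K] {O : NSOperad.{u, w} K}
    (J : O.OperadIdeal) : NSOperad.{u, w} K where
  toOperadData := J.quotientData
  isOperad :=
    { one_comp := fun {n} a => by
        obtain ⟨a, rfl⟩ := (J.carrier n).mkQ_surjective a
        refine Eq.trans ?_ (sigma_mk_mkQ J.carrier (O.isOperad.one_comp a))
        exact congrArg (Sigma.mk _)
          (J.quotientData_comp_mk (fun _ : Fin 1 => n) O.one (fun _ => a))
      comp_one := fun {n} a => by
        obtain ⟨a, rfl⟩ := (J.carrier n).mkQ_surjective a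
        refine Eq.trans ?_ (sigma_mk_mkQ J.carrier (O.isOperad.comp_one a))
        exact congrArg (Sigma.mk _)
          (J.quotientData_comp_mk (fun _ : Fin n => 1) a (fun _ => O.one))
      assoc := fun {n} k l a b c => by
        obtain ⟨a, rfl⟩ := (J.carrier n).mkQ_surjective a
        choose b' hb using fun i => (J.carrier (k i)).mkQ_surjective (b i)
        choose c' hc using fun p => (J.carrier (l p)).mkQ_surjective (c p)
        obtain rfl : (fun i => (J.carrier (k i)).mkQ (b' i)) = b := funext hb
        obtain rfl : (fun p => (J.carrier (l p)).mkQ (c' p)) = c := funext hc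
        refine Eq.trans ?_ ((sigma_mk_mkQ J.carrier (O.isOperad.assoc k l a b' c')).trans ?_)
        · refine congrArg (Sigma.mk _) ?_
          rw [J.quotientData_comp_mk k a b']
          exact J.quotientData_comp_mk (fun m => l (finSigmaFinEquiv.symm m)) (O.comp k a b')
            (fun m => c' (finSigmaFinEquiv.symm m))
        · refine congrArg (Sigma.mk _) ?_
          have : ∀ i, J.quotientData.comp (fun j => l ⟨i, j⟩) ((J.carrier (k i)).mkQ (b' i))
              (fun j => (J.carrier (l ⟨i, j⟩)).mkQ (c' ⟨i, j⟩)) =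
              (J.carrier (∑ j, l ⟨i, j⟩)).mkQ
                (O.comp (fun j => l ⟨i, j⟩) (b' i) (fun j => c' ⟨i, j⟩)) :=
            fun i => J.quotientData_comp_mk _ _ _
          simp only [this]
          exact (J.quotientData_comp_mk (fun i => ∑ j, l ⟨i, j⟩) a
            (fun i => O.comp (fun j => l ⟨i, j⟩) (b' i) (fun j => c' ⟨i, j⟩))).symm }

/-! ### Operads described on a basis -/

/-- The multilinear map on spaces with bases `B i` whose values on basis elements are given. -/
def multilinearExtension (K : Type u) [Field K] {n : ℕ} {B : Fin n → Type v} {M : Type w}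
    [AddCommGroup M] [Module K M] (f : (∀ i, B i) → M) :
    MultilinearMap K (fun i => B i →₀ K) M :=
  ((Basis.piTensorProduct (fun i => (Finsupp.basisSingleOne : Module.Basis (B i) K (B i →₀ K)))
    ).constr K f).compMultilinearMap (PiTensorProduct.tprod K)

theorem multilinearExtension_single (K : Type u) [Field K] {n : ℕ} {B : Fin n → Type v}
    {M : Type w} [AddCommGroup M] [Module K M] (f : (∀ i, B i) → M) (s : ∀ i, B i) :
    multilinearExtension K f (fun i => Finsupp.single (s i) 1) = f s := by
  have := (Basis.piTensorProduct
    (fun i => (Finsupp.basisSingleOne : Module.Basis (B i) K (B i →₀ K)))).constr_basis K f s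
  simpa [multilinearExtension] using this

/-- The data of an operad with `obj n` the vector space with basis `B n`: the compositions are
extended multilinearly from their values `op` on basis elements. -/
def OperadData.ofBasis (K : Type u) [Field K] (B : ℕ → Type v) (one : B 1 →₀ K)
    (op : ∀ {n : ℕ} (k : Fin n → ℕ), B n → (∀ i, B (k i)) → (B (∑ i, k i) →₀ K)) :
    OperadData.{u, max u v} K where
  obj n := B n →₀ K
  one := one
  comp k := Finsupp.linearCombination K (fun t => multilinearExtension K (op k t))

/-- The basis element of `obj n` given by `t : B n`. -/
def OperadData.basisElement (K : Type u) [Field K] {B : ℕ → Type v} {one : B 1 →₀ K}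
    {op : ∀ {n : ℕ} (k : Fin n → ℕ), B n → (∀ i, B (k i)) → (B (∑ i, k i) →₀ K)}
    {n : ℕ} (t : B n) : (OperadData.ofBasis K B one op).obj n :=
  Finsupp.single t (1 : K)

theorem OperadData.ofBasis_comp (K : Type u) [Field K] (B : ℕ → Type v) (one : B 1 →₀ K)
    (op : ∀ {n : ℕ} (k : Fin n → ℕ), B n → (∀ i, B (k i)) → (B (∑ i, k i) →₀ K))
    {n : ℕ} (k : Fin n → ℕ) (t : B n) (s : ∀ i, B (k i)) :
    (OperadData.ofBasis K B one op).comp k (basisElement K t) (fun i => basisElement K (s i)) =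
      op k t s := by
  have h : Finsupp.linearCombination K (fun t => multilinearExtension K (op k t))
      (Finsupp.single t (1 : K)) = multilinearExtension K (op k t) := by
    rw [Finsupp.linearCombination_single, one_smul]
  exact (congrArg (fun f : MultilinearMap K _ _ => f (fun i => Finsupp.single (s i) (1 : K))) h).trans
    (multilinearExtension_single K (op k t) s)

/-- Transport between components of equal arities. -/
def OperadData.castEquiv {K : Type u} [Field K] (O : OperadData.{u, w} K) {m n : ℕ} (h : m = n) :
    O.obj m ≃ₗ[K] O.obj n := by
  subst h
  exact LinearEquiv.refl K _

theorem OperadData.sigma_eq_iff {K : Type u} [Field K] (O : OperadData.{u, w} K) {m n : ℕ}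
    (h : m = n) (x : O.obj m) (y : O.obj n) :
    (⟨m, x⟩ : Σ n, O.obj n) = ⟨n, y⟩ ↔ O.castEquiv h x = y := by
  subst h
  simp [OperadData.castEquiv]

theorem sum_finSigmaFinEquiv_symm {n : ℕ} (k : Fin n → ℕ) (l : (Σ i, Fin (k i)) → ℕ) :
    ∑ m, l (finSigmaFinEquiv.symm m) = ∑ i, ∑ j, l ⟨i, j⟩ := by
  rw [Equiv.sum_comp finSigmaFinEquiv.symm l, Fintype.sum_sigma]

/-- For fixed `b₁, …, bₙ`, the linear map `a ↦ a ∘ (b₁, …, bₙ)`. -/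
def OperadData.compLeft {K : Type u} [Field K] (O : OperadData.{u, w} K) {n : ℕ} (k : Fin n → ℕ)
    (b : ∀ i, O.obj (k i)) : O.obj n →ₗ[K] O.obj (∑ i, k i) where
  toFun a := O.comp k a b
  map_add' a a' := by simp
  map_smul' r a := by simp

/-- The axioms of an operad may be checked on bases. -/
theorem OperadData.isOperad_of_basis {K : Type u} [Field K] (O : OperadData.{u, w} K)
    {B : ℕ → Type v} (e : ∀ n, Module.Basis (B n) K (O.obj n))
    (one_comp : ∀ {n : ℕ} (a : B n),
      (⟨_, O.comp (fun _ : Fin 1 => n) O.one (fun _ => e n a)⟩ : Σ m, O.obj m) = ⟨n, e n a⟩)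
    (comp_one : ∀ {n : ℕ} (a : B n),
      (⟨_, O.comp (fun _ : Fin n => 1) (e n a) (fun _ => O.one)⟩ : Σ m, O.obj m) = ⟨n, e n a⟩)
    (assoc : ∀ {n : ℕ} (k : Fin n → ℕ) (l : (Σ i, Fin (k i)) → ℕ)
      (a : B n) (b : ∀ i, B (k i)) (c : ∀ p, B (l p)),
      (⟨_, O.comp (fun m => l (finSigmaFinEquiv.symm m))
          (O.comp k (e n a) (fun i => e _ (b i)))
          (fun m => e _ (c (finSigmaFinEquiv.symm m)))⟩ : Σ m, O.obj m) =
        ⟨_, O.comp (fun i => ∑ j, l ⟨i, j⟩) (e n a)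
          (fun i => O.comp (fun j => l ⟨i, j⟩) (e _ (b i)) (fun j => e _ (c ⟨i, j⟩)))⟩) :
    O.IsOperad where
  one_comp {n} a := by
    have h : ∑ _i : Fin 1, n = n := by simp
    rw [O.sigma_eq_iff h]
    have key : (O.castEquiv h).toLinearMap.compMultilinearMap (O.comp (fun _ : Fin 1 => n) O.one) =
        MultilinearMap.ofSubsingleton K (O.obj n) (O.obj n) (0 : Fin 1) LinearMap.id := by
      refine Module.Basis.ext_multilinear (fun _ => e n) (fun v => ?_)
      obtain ⟨v₀, rfl⟩ : ∃ v₀, v = fun _ => v₀ :=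
        ⟨v 0, funext (fun i => congrArg v (Subsingleton.elim i 0))⟩
      exact (O.sigma_eq_iff h _ _).1 (one_comp v₀)
    exact congrArg (fun f : MultilinearMap K _ _ => f (fun _ => a)) key
  comp_one {n} a := by
    have h : ∑ _i : Fin n, 1 = n := by simp
    rw [O.sigma_eq_iff h]
    have key : (O.castEquiv h).toLinearMap ∘ₗ O.compLeft (fun _ : Fin n => 1) (fun _ => O.one) =
        LinearMap.id :=
      (e n).ext (fun v => (O.sigma_eq_iff h _ _).1 (comp_one v))
    exact congrArg (fun f : O.obj n →ₗ[K] O.obj n => f a) key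
  assoc {n} k l a b c := by
    have h := sum_finSigmaFinEquiv_symm k l
    rw [O.sigma_eq_iff h]
    have key₁ : ∀ (b : ∀ i, B (k i)) (c : ∀ p, B (l p)) (a : O.obj n),
        O.castEquiv h (O.comp (fun m => l (finSigmaFinEquiv.symm m))
          (O.comp k a (fun i => e _ (b i))) (fun m => e _ (c (finSigmaFinEquiv.symm m)))) =
        O.comp (fun i => ∑ j, l ⟨i, j⟩) a
          (fun i => O.comp (fun j => l ⟨i, j⟩) (e _ (b i)) (fun j => e _ (c ⟨i, j⟩))) := by
      intro b c a
      have key : (O.castEquiv h).toLinearMap ∘ₗ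
          O.compLeft (fun m => l (finSigmaFinEquiv.symm m))
            (fun m => e _ (c (finSigmaFinEquiv.symm m))) ∘ₗ O.compLeft k (fun i => e _ (b i)) =
          O.compLeft (fun i => ∑ j, l ⟨i, j⟩)
            (fun i => O.comp (fun j => l ⟨i, j⟩) (e _ (b i)) (fun j => e _ (c ⟨i, j⟩))) :=
        (e n).ext (fun v => (O.sigma_eq_iff h _ _).1 (assoc k l v b c))
      exact congrArg (fun f : O.obj n →ₗ[K] _ => f a) key
    have key₂ : ∀ (c : ∀ p, B (l p)) (b : ∀ i, O.obj (k i)),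
        O.castEquiv h (O.comp (fun m => l (finSigmaFinEquiv.symm m))
          (O.comp k a b) (fun m => e _ (c (finSigmaFinEquiv.symm m)))) =
        O.comp (fun i => ∑ j, l ⟨i, j⟩) a
          (fun i => O.comp (fun j => l ⟨i, j⟩) (b i) (fun j => e _ (c ⟨i, j⟩))) := by
      intro c b
      have key : ((O.castEquiv h).toLinearMap ∘ₗ
          O.compLeft (fun m => l (finSigmaFinEquiv.symm m))
            (fun m => e _ (c (finSigmaFinEquiv.symm m)))).compMultilinearMap (O.comp k a) =
          (O.comp (fun i => ∑ j, l ⟨i, j⟩) a).compLinearMap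
            (fun i => O.compLeft (fun j => l ⟨i, j⟩) (fun j => e _ (c ⟨i, j⟩))) :=
        Module.Basis.ext_multilinear (fun i => e (k i)) (fun v => key₁ v c a)
      exact congrArg (fun f : MultilinearMap K _ _ => f b) key
    have key : (O.castEquiv h).toLinearMap.compMultilinearMap
        ((MultilinearMap.domDomCongrLinearEquiv' K K (fun p => O.obj (l p)) _
          finSigmaFinEquiv).symm (O.comp (fun m => l (finSigmaFinEquiv.symm m)) (O.comp k a b))) =
        (O.comp (fun i => ∑ j, l ⟨i, j⟩) a).compMultilinearMap
          (fun i => O.comp (fun j => l ⟨i, j⟩) (b i)) :=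
      Module.Basis.ext_multilinear (fun p => e (l p)) (fun v => key₂ v b)
    exact congrArg (fun f : MultilinearMap K _ _ => f c) key

/-! ### The free nonsymmetric operad on binary generators -/

/-- Grafting the trees `f 0, f 1, …` on the leaves of a planar binary tree (numbered from left to
right). -/
def graft {X : Type v} : (t : BinaryTree X) → (Fin t.numLeaves → BinaryTree X) → BinaryTree X
  | .nil, f => f ⟨0, Nat.one_pos⟩
  | .node x l r, f =>
      .node x (graft l (fun i => f (Fin.castAdd r.numLeaves i)))
        (graft r (fun i => f (Fin.natAdd l.numLeaves i)))

theorem numLeaves_graft {X : Type v} (t : BinaryTree X) (f : Fin t.numLeaves → BinaryTree X) :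
    (graft t f).numLeaves = ∑ i, (f i).numLeaves := by
  induction t with
  | nil => exact (Fin.sum_univ_one (fun i : Fin 1 => (f i).numLeaves)).symm
  | node x l r hl hr =>
    simp only [graft, BinaryTree.numLeaves, hl, hr]
    exact (Fin.sum_univ_add (fun i => (f i).numLeaves)).symm

/-- Planar binary trees with `n` leaves, whose internal vertices are decorated by `X`. -/
abbrev PlanarTree (X : Type v) (n : ℕ) : Type v := {t : BinaryTree X // t.numLeaves = n}

/-- Grafting of planar trees, with control of the number of leaves. -/
def PlanarTree.graft {X : Type v} {n : ℕ} (k : Fin n → ℕ) (t : PlanarTree X n)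
    (s : ∀ i, PlanarTree X (k i)) : PlanarTree X (∑ i, k i) :=
  ⟨_root_.graft t.1 (fun j => (s (Fin.cast t.2 j)).1), by
    obtain ⟨t, rfl⟩ := t
    rw [numLeaves_graft]
    exact Finset.sum_congr rfl (fun i _ => (s i).2)⟩

/-- Unit and composition of the free operad: the tree without internal vertex, and grafting. -/
def freeOperadData (K : Type u) [Field K] (X : Type v) : OperadData.{u, max u v} K :=
  OperadData.ofBasis K (PlanarTree X) (Finsupp.single ⟨.nil, rfl⟩ 1)
    (fun k t s => Finsupp.single (PlanarTree.graft k t s) 1)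

/-- A version of grafting used in proofs only: the grafted trees are given by a sequence. -/
def graftSeq {X : Type v} : BinaryTree X → (ℕ → BinaryTree X) → BinaryTree X
  | .nil, F => F 0
  | .node x l r, F => .node x (graftSeq l F) (graftSeq r (fun i => F (l.numLeaves + i)))

theorem graft_eq_graftSeq {X : Type v} (t : BinaryTree X) (f : Fin t.numLeaves → BinaryTree X)
    (F : ℕ → BinaryTree X) (h : ∀ i, f i = F i) : graft t f = graftSeq t F := by
  induction t generalizing F with
  | nil => exact h _
  | node x l r hl hr =>
    simp only [graft, graftSeq]
    rw [hl _ F (fun i => h _), hr _ (fun i => F (l.numLeaves + i)) (fun i => h _)]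

theorem numLeaves_graftSeq {X : Type v} (t : BinaryTree X) (F : ℕ → BinaryTree X) :
    (graftSeq t F).numLeaves = ∑ i ∈ Finset.range t.numLeaves, (F i).numLeaves := by
  rw [← graft_eq_graftSeq t (fun i => F i) F (fun _ => rfl), numLeaves_graft,
    Finset.sum_range (fun i => (F i).numLeaves)]

theorem graftSeq_graftSeq {X : Type v} (t : BinaryTree X) (F G : ℕ → BinaryTree X) :
    graftSeq (graftSeq t F) G = graftSeq t (fun i => graftSeq (F i)
      (fun j => G (∑ i' ∈ Finset.range i, (F i').numLeaves + j))) := by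
  induction t generalizing F G with
  | nil => simp [graftSeq]
  | node x l r hl hr =>
    simp only [graftSeq, hl, hr, numLeaves_graftSeq, Finset.sum_range_add, add_assoc]

theorem graftSeq_congr {X : Type v} (t : BinaryTree X) (F G : ℕ → BinaryTree X)
    (h : ∀ i < t.numLeaves, F i = G i) : graftSeq t F = graftSeq t G := by
  rw [← graft_eq_graftSeq t (fun i => F i) F (fun _ => rfl)]
  exact graft_eq_graftSeq t _ G (fun i => h i i.2)

theorem graft_nil {X : Type v} (t : BinaryTree X) : graft t (fun _ => .nil) = t := by
  induction t with
  | nil => rfl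
  | node x l r hl hr => simp only [graft, hl, hr]

theorem PlanarTree.graft_graft {X : Type v} {n : ℕ} (k : Fin n → ℕ) (l : (Σ i, Fin (k i)) → ℕ)
    (t : PlanarTree X n) (s : ∀ i, PlanarTree X (k i)) (u : ∀ p, PlanarTree X (l p)) :
    (PlanarTree.graft (fun m => l (finSigmaFinEquiv.symm m)) (PlanarTree.graft k t s)
      (fun m => u (finSigmaFinEquiv.symm m))).1 =
    (PlanarTree.graft (fun i => ∑ j, l ⟨i, j⟩) t
      (fun i => PlanarTree.graft (fun j => l ⟨i, j⟩) (s i) (fun j => u ⟨i, j⟩))).1 := by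
  obtain ⟨t, rfl⟩ := t
  let F : ℕ → BinaryTree X := fun i => if h : i < t.numLeaves then (s ⟨i, h⟩).1 else .nil
  let G : ℕ → BinaryTree X := fun m =>
    if h : m < ∑ i, k i then (u (finSigmaFinEquiv.symm ⟨m, h⟩)).1 else .nil
  have hF : ∀ i : Fin t.numLeaves, (s i).1 = F i := fun i => by simp [F]
  have hFl : ∀ i : Fin t.numLeaves, (F i).numLeaves = k i := fun i => by rw [← hF, (s i).2]
  have h₁ : (PlanarTree.graft k ⟨t, rfl⟩ s).1 = graftSeq t F :=
    graft_eq_graftSeq t _ F (fun i => hF i)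
  have h₂ : (PlanarTree.graft (fun m => l (finSigmaFinEquiv.symm m))
      (PlanarTree.graft k ⟨t, rfl⟩ s) (fun m => u (finSigmaFinEquiv.symm m))).1 =
      graftSeq (graftSeq t F) G := by
    rw [← h₁]
    refine graft_eq_graftSeq _ _ G (fun m => ?_)
    have hm : (m : ℕ) < ∑ i, k i := lt_of_lt_of_eq m.2 (PlanarTree.graft k ⟨t, rfl⟩ s).2
    simp only [G, dif_pos hm]
    rfl
  rw [h₂, graftSeq_graftSeq]
  symm
  refine graft_eq_graftSeq t _ _ (fun i => ?_)
  rw [← hF i]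
  refine graft_eq_graftSeq (s i).1 _ _ (fun j => ?_)
  have hj : (j : ℕ) < k i := lt_of_lt_of_eq j.2 (s i).2
  have hsum : ∑ i' ∈ Finset.range i, (F i').numLeaves + j =
      (finSigmaFinEquiv (⟨i, ⟨j, hj⟩⟩ : Σ i, Fin (k i)) : ℕ) := by
    rw [finSigmaFinEquiv_apply, Finset.sum_range]
    congr 1
    exact Finset.sum_congr rfl (fun i' _ => hFl (Fin.castLE i.2.le i'))
  have hlt : ∑ i' ∈ Finset.range i, (F i').numLeaves + j < ∑ i, k i := by
    rw [hsum]
    exact Fin.is_lt _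
  simp only [G, dif_pos hlt]
  have : (⟨_, hlt⟩ : Fin (∑ i, k i)) = finSigmaFinEquiv (⟨i, ⟨j, hj⟩⟩ : Σ i, Fin (k i)) :=
    Fin.ext hsum
  rw [this, Equiv.symm_apply_apply]
  rfl

/-- The element of the free operad given by a tree. -/
def treeElement (K : Type u) [Field K] {X : Type v} {n : ℕ} (t : PlanarTree X n) :
    (freeOperadData K X).obj n :=
  Finsupp.single t (1 : K)

/-- The trees with `n` leaves are a basis of the component of arity `n` of the free operad. -/
def treeBasis (K : Type u) [Field K] (X : Type v) (n : ℕ) :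
    Module.Basis (PlanarTree X n) K ((freeOperadData K X).obj n) :=
  (Finsupp.basisSingleOne : Module.Basis (PlanarTree X n) K (PlanarTree X n →₀ K))

theorem treeBasis_apply (K : Type u) [Field K] {X : Type v} {n : ℕ} (t : PlanarTree X n) :
    treeBasis K X n t = treeElement K t := by
  exact congrFun (Finsupp.coe_basisSingleOne (R := K)) t

theorem freeOperadData_comp (K : Type u) [Field K] {X : Type v} {n : ℕ} (k : Fin n → ℕ)
    (t : PlanarTree X n) (s : ∀ i, PlanarTree X (k i)) :
    (freeOperadData K X).comp k (treeElement K t) (fun i => treeElement K (s i)) =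
      treeElement K (PlanarTree.graft k t s) :=
  OperadData.ofBasis_comp K _ _ _ k t s

theorem sigma_treeElement_eq (K : Type u) [Field K] {X : Type v} {m n : ℕ}
    {s : PlanarTree X m} {t : PlanarTree X n} (h : s.1 = t.1) :
    (⟨m, treeElement K s⟩ : Σ n, (freeOperadData K X).obj n) = ⟨n, treeElement K t⟩ := by
  obtain ⟨s, rfl⟩ := s
  obtain ⟨t, rfl⟩ := t
  dsimp only at h
  subst h
  rfl

theorem freeOperadData_isOperad (K : Type u) [Field K] (X : Type v) :
    (freeOperadData K X).IsOperad := by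
  refine OperadData.isOperad_of_basis (freeOperadData K X) (treeBasis K X) ?_ ?_ ?_
  · intro n a
    simp only [treeBasis_apply]
    refine (congrArg (Sigma.mk _) (freeOperadData_comp K (fun _ : Fin 1 => n)
      ⟨.nil, rfl⟩ (fun _ => a))).trans (sigma_treeElement_eq K ?_)
    rfl
  · intro n a
    simp only [treeBasis_apply]
    refine (congrArg (Sigma.mk _) (freeOperadData_comp K (fun _ : Fin n => 1) a
      (fun _ => ⟨.nil, rfl⟩))).trans (sigma_treeElement_eq K ?_)
    exact graft_nil a.1
  · intro n k l a b c
    simp only [treeBasis_apply, freeOperadData_comp]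
    exact sigma_treeElement_eq K (PlanarTree.graft_graft k l a b c)

/-- The free nonsymmetric operad on a set `X` of binary generators (equivalently, on the vector
space `KX` placed in arity `2`). -/
def freeOperad (K : Type u) [Field K] (X : Type v) : NSOperad.{u, max u v} K where
  toOperadData := freeOperadData K X
  isOperad := freeOperadData_isOperad K X

/-! ### Binary quadratic operads and their Koszul duals -/

/-- The generator `x`, as a tree with two leaves. -/
def PlanarTree.corolla {X : Type v} (x : X) : PlanarTree X 2 := ⟨.node x .nil .nil, rfl⟩

/-- The tree monomial `x ∘₁ y`. -/
def PlanarTree.circOne {X : Type v} (x y : X) : PlanarTree X 3 :=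
  ⟨.node x (.node y .nil .nil) .nil, rfl⟩

/-- The tree monomial `x ∘₂ y`. -/
def PlanarTree.circTwo {X : Type v} (x y : X) : PlanarTree X 3 :=
  ⟨.node x .nil (.node y .nil .nil), rfl⟩

theorem PlanarTree.circOne_eq_graft {X : Type v} (x y : X) :
    (PlanarTree.circOne x y).1 = _root_.graft (corolla x).1 ![(corolla y).1, .nil] := rfl

theorem PlanarTree.circTwo_eq_graft {X : Type v} (x y : X) :
    (PlanarTree.circTwo x y).1 = _root_.graft (corolla x).1 ![.nil, (corolla y).1] := rfl

/-- A binary quadratic presentation of a nonsymmetric operad: binary generators indexed by `X` and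
a space `rel` of relations between the monomials `x ∘₁ y` and `x ∘₂ y`. -/
structure BinaryQuadraticData (K : Type u) [Field K] (X : Type v) where
  rel : Submodule K ((freeOperad K X).obj 3)

/-- The operad with a given binary quadratic presentation. -/
def BinaryQuadraticData.operad {K : Type u} [Field K] {X : Type v} (D : BinaryQuadraticData K X) :
    NSOperad.{u, max u v} K :=
  ((freeOperad K X).idealSpan (D.rel : Set ((freeOperad K X).obj 3))).quotient

/-- The pairing between the components of arity `3` of the free operads generated by `(KX)*` and by
`KX`. The space `(KX)*` is identified with `KX` through the dual basis; the monomials `x ∘₁ y` are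
paired with sign `+`, the monomials `x ∘₂ y` with sign `-`, and all other pairings of
monomials are zero. -/
def koszulPairing {K : Type u} [Field K] {X : Type v} [Fintype X]
    (f g : (freeOperad K X).obj 3) : K :=
  ∑ x, ∑ y,
    ((treeBasis K X 3).repr f (.circOne x y) * (treeBasis K X 3).repr g (.circOne x y) -
      (treeBasis K X 3).repr f (.circTwo x y) * (treeBasis K X 3).repr g (.circTwo x y))

theorem koszulPairing_add_left {K : Type u} [Field K] {X : Type v} [Fintype X]
    (f f' g : (freeOperad K X).obj 3) :
    koszulPairing (f + f') g = koszulPairing f g + koszulPairing f' g := by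
  simp only [koszulPairing, ← Finset.sum_add_distrib]
  refine Finset.sum_congr rfl (fun x _ => Finset.sum_congr rfl (fun y _ => ?_))
  rw [show (treeBasis K X 3).repr (f + f') = (treeBasis K X 3).repr f + (treeBasis K X 3).repr f'
    from map_add (treeBasis K X 3).repr f f']
  simp only [Finsupp.add_apply]
  ring

theorem koszulPairing_smul_left {K : Type u} [Field K] {X : Type v} [Fintype X]
    (r : K) (f g : (freeOperad K X).obj 3) :
    koszulPairing (r • f) g = r * koszulPairing f g := by
  simp only [koszulPairing, Finset.mul_sum]
  refine Finset.sum_congr rfl (fun x _ => Finset.sum_congr rfl (fun y _ => ?_))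
  rw [show (treeBasis K X 3).repr (r • f) = r • (treeBasis K X 3).repr f
    from map_smul (treeBasis K X 3).repr r f]
  simp only [Finsupp.smul_apply, smul_eq_mul]
  ring

/-- The Koszul dual presentation: the generators are dual to those of `D`, and the space of
relations is the orthogonal of that of `D`. -/
def BinaryQuadraticData.koszulDual {K : Type u} [Field K] {X : Type v} [Fintype X]
    (D : BinaryQuadraticData K X) : BinaryQuadraticData K X where
  rel :=
    { carrier := {f | ∀ g ∈ D.rel, koszulPairing f g = 0}
      add_mem' := fun {f f'} hf hf' g hg => by
        rw [koszulPairing_add_left, hf g hg, hf' g hg, add_zero]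
      zero_mem' := fun g _ => by
        have := koszulPairing_smul_left (0 : K) (0 : (freeOperad K X).obj 3) g
        rwa [zero_smul, zero_mul] at this
      smul_mem' := fun r f hf g hg => by
        rw [koszulPairing_smul_left, hf g hg, mul_zero] }

/-! ### The operad of two-parameters associative algebras -/

/-- The presentation of the operad of two-parameters associative algebras over the semigroup `Ω`
(the operation of `Ω` is written multiplicatively): generators `*_(α,β)`, and relations
`*_(αβ,γ) ∘₁ *_(α,β) = *_(α,βγ) ∘₂ *_(β,γ)`. -/
def twoParameterAs (K : Type u) [Field K] (Ω : Type v) [Semigroup Ω] :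
    BinaryQuadraticData K (Ω × Ω) where
  rel := Submodule.span K (Set.range fun p : Ω × Ω × Ω =>
    treeElement K (.circOne (p.1 * p.2.1, p.2.2) (p.1, p.2.1)) -
      treeElement K (.circTwo (p.1, p.2.1 * p.2.2) (p.2.1, p.2.2)))

/-! ### The operad of words -/

/-- Nonempty words of length `n` with letters in `Ω`; there is none if `n = 0`. -/
abbrev OmegaWord (Ω : Type v) (n : ℕ) : Type v := {l : List Ω // l.length = n ∧ l ≠ []}

/-- The `i`-th letter of a word. -/
def OmegaWord.letter {Ω : Type v} {n : ℕ} (w : OmegaWord Ω n) (i : Fin n) : Ω :=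
  w.1.get (Fin.cast w.2.1.symm i)

/-- The product `α₁ → α₂ → ⋯ → αₙ` in the semigroup `Ω` of the letters of a nonempty list. -/
def semigroupProd {Ω : Type v} [Semigroup Ω] : (l : List Ω) → l ≠ [] → Ω
  | [], h => absurd rfl h
  | α :: l, _ => l.foldl (· * ·) α

/-- The product in `Ω` of the letters of a word. -/
def OmegaWord.value {Ω : Type v} [Semigroup Ω] {n : ℕ} (w : OmegaWord Ω n) : Ω :=
  semigroupProd w.1 w.2.2

/-- The concatenation of `n ≥ 1` words of lengths `k₁, …, kₙ`. -/
def OmegaWord.concat {Ω : Type v} {n : ℕ} (hn : n ≠ 0) (k : Fin n → ℕ)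
    (w : ∀ i, OmegaWord Ω (k i)) : OmegaWord Ω (∑ i, k i) :=
  ⟨(List.ofFn fun i => (w i).1).flatten, by
    constructor
    · rw [List.length_flatten, List.map_ofFn, List.sum_ofFn]
      exact Finset.sum_congr rfl (fun i _ => (w i).2.1)
    · rw [Ne, List.flatten_eq_nil_iff]
      intro h
      exact (w ⟨0, Nat.pos_of_ne_zero hn⟩).2.2 (h _ (List.mem_ofFn.2 ⟨_, rfl⟩))⟩

theorem OmegaWord.arity_ne_zero {Ω : Type v} {n : ℕ} (w : OmegaWord Ω n) : n ≠ 0 := by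
  rintro rfl
  exact w.2.2 (List.length_eq_zero_iff.1 w.2.1)

/-- The data of the operad `P` of words: `P(n) = (KΩ)^{⊗ n}` for `n ≥ 1`, seen as the space with
basis the words of length `n` (and `P(0) = 0`); the unit is the sum of the letters; a composition
of words `α₁…αₙ ∘ (w₁, …, wₙ)` is the concatenation `w₁…wₙ` if each `αᵢ` is the product in
`Ω` of the letters of `wᵢ`, and zero otherwise. -/
def wordOperadData (K : Type u) [Field K] (Ω : Type v) [Semigroup Ω] [Fintype Ω]
    [DecidableEq Ω] : OperadData.{u, max u v} K :=
  OperadData.ofBasis K (OmegaWord Ω)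
    (∑ α : Ω, Finsupp.single ⟨[α], rfl, List.cons_ne_nil _ _⟩ 1)
    (fun k a w => Finsupp.single (OmegaWord.concat a.arity_ne_zero k w)
      (∏ i, if a.letter i = (w i).value then (1 : K) else 0))

/-- The element of the operad `P` given by a word. -/
def wordElement (K : Type u) [Field K] {Ω : Type v} [Semigroup Ω] [Fintype Ω]
    [DecidableEq Ω] {n : ℕ} (w : OmegaWord Ω n) : (wordOperadData K Ω).obj n :=
  Finsupp.single w (1 : K)

/-- The words of length `n` are a basis of `P(n)`. -/
def wordBasis (K : Type u) [Field K] (Ω : Type v) [Semigroup Ω] [Fintype Ω]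
    [DecidableEq Ω] (n : ℕ) : Module.Basis (OmegaWord Ω n) K ((wordOperadData K Ω).obj n) :=
  (Finsupp.basisSingleOne : Module.Basis (OmegaWord Ω n) K (OmegaWord Ω n →₀ K))

/-- The subspaces `P₀(1) = K I` and `P₀(n) = P(n)` for `n ≠ 1`. -/
def wordSuboperadCarrier (K : Type u) [Field K] (Ω : Type v) [Semigroup Ω] [Fintype Ω]
    [DecidableEq Ω] (n : ℕ) : Submodule K ((wordOperadData K Ω).obj n) :=
  match n with
  | 1 => Submodule.span K {(wordOperadData K Ω).one}
  | _ => ⊤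

end

/-!
An element of the operad of words is determined by its coefficients, and in these coordinates the
composition reads: the coefficient of `v₁…vₙ` in `a ∘ (b₁, …, bₙ)` is the product of the
coefficients of the `vᵢ` in the `bᵢ` and of the coefficient in `a` of the word whose letters are
the products of the words `vᵢ` (`wordCoeff_comp`).

A planar tree `t` decorated by pairs of elements of `Ω` *accepts* a word when, its letters being
placed on the leaves of `t`, every vertex is decorated by the pair formed by the product of the
letters above its left input and the product of the letters above its right input. Acceptance is
compatible with grafting (`accepts_graft`), exactly in the way which the formula above requires.
Therefore `t ↦ ∑ w`, the sum being over the words accepted by `t`, defines a morphism of operads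
from the free operad to the operad of words (`treeEvalHom`). The isomorphism is induced by this
morphism; it remains to identify its kernel and its image.

* The orthogonal of the relations consists of the `f` whose coefficients on the two trees accepting
  `αβγ` have sum zero, for all `α, β, γ` (`mem_koszulDual_rel_iff`). As the sum of these two
  coefficients is the coefficient of `αβγ` in the image of `f`, the relations are in the kernel
  (`koszulDual_rel_le_ker`).
* Modulo the relations, two vertices which cannot accept a word together give zero, and the others
  can be reassociated to the right. Hence a tree with at least two leaves is congruent to zero or
  to the right comb of a word (`treeMem_or_treeCongr_rightComb`). The right comb of a word of
  length at least two accepts this word only, so that these combs are sent to a basis. This gives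
  both the equality of the kernel with the ideal of relations (`dualIdeal_eq_ker`) and the
  surjectivity in arity at least two (`range_treeEval`).
* In arity one, the only tree is the unit, which is sent to `I ≠ 0`.
-/

noncomputable section

/-! ### Lists indexed by blocks -/

/-- Reading a family indexed by `Σ i, Fin (k i)` in lexicographic order amounts to reading it block
by block. -/
theorem List.ofFn_finSigmaFinEquiv_symm {α : Type*} {n : ℕ} (k : Fin n → ℕ)
    (g : (Σ i, Fin (k i)) → α) :
    List.ofFn (fun m => g (finSigmaFinEquiv.symm m)) =
      (List.ofFn fun i => List.ofFn fun j => g ⟨i, j⟩).flatten := by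
  induction n with
  | zero => simp
  | succ n ih =>
    rw [List.ofFn_succ' (n := n), List.concat_eq_append, List.flatten_append,
      List.flatten_singleton,
      ← ih (fun i => k i.castSucc) (fun p => g ⟨p.1.castSucc, p.2⟩),
      List.ofFn_congr (Fin.sum_univ_castSucc k), List.ofFn_add]
    congr 1
    · congr 1
      funext m
      obtain ⟨p, rfl⟩ := finSigmaFinEquiv.surjective m
      rw [Equiv.symm_apply_apply]
      refine congrArg g ?_
      rw [Equiv.symm_apply_eq]
      refine Fin.ext ?_
      rw [finSigmaFinEquiv_apply]
      exact finSigmaFinEquiv_apply p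
    · congr 1
      funext j
      refine congrArg g ?_
      rw [Equiv.symm_apply_eq]
      refine Fin.ext ?_
      rw [finSigmaFinEquiv_apply]
      simp only [Fin.val_cast, Fin.val_natAdd]
      rfl

/-! ### Products of words -/

/-- The product of a list of elements of a semigroup, in the monoid obtained by adjoining a unit:
this makes sense for the empty list as well. -/
def listProd {Ω : Type v} [Semigroup Ω] (l : List Ω) : WithOne Ω :=
  (l.map ((↑) : Ω → WithOne Ω)).prod

@[simp] theorem listProd_nil {Ω : Type v} [Semigroup Ω] : listProd ([] : List Ω) = 1 := rfl

@[simp] theorem listProd_singleton {Ω : Type v} [Semigroup Ω] (a : Ω) : listProd [a] = a := by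
  simp [listProd]

@[simp] theorem listProd_append {Ω : Type v} [Semigroup Ω] (l l' : List Ω) :
    listProd (l ++ l') = listProd l * listProd l' := by
  simp [listProd]

theorem listProd_cons {Ω : Type v} [Semigroup Ω] (a : Ω) (l : List Ω) :
    listProd (a :: l) = a * listProd l := by
  simp [listProd]

theorem coe_semigroupProd {Ω : Type v} [Semigroup Ω] (l : List Ω) (h : l ≠ []) :
    ((semigroupProd l h : Ω) : WithOne Ω) = listProd l := by
  have aux : ∀ (l : List Ω) (a : Ω), ((l.foldl (· * ·) a : Ω) : WithOne Ω) = a * listProd l := by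
    intro l
    induction l with
    | nil => simp
    | cons b l ih =>
      intro a
      rw [List.foldl_cons, ih, listProd_cons, WithOne.coe_mul, mul_assoc]
  cases l with
  | nil => exact absurd rfl h
  | cons a l => rw [listProd_cons]; exact aux l a

/-- If the letters of a word are the products of the blocks `L i`, the product of the word is that
of the concatenated blocks. -/
theorem listProd_ofFn {Ω : Type v} [Semigroup Ω] {n : ℕ} (u : Fin n → Ω) (L : Fin n → List Ω)
    (h : ∀ i, (u i : WithOne Ω) = listProd (L i)) :
    listProd (List.ofFn u) = listProd (List.ofFn L).flatten := by
  induction n with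
  | zero => rfl
  | succ n ih =>
    rw [List.ofFn_succ, List.ofFn_succ, List.flatten_cons, listProd_append, listProd_cons, h,
      ih _ _ fun i => h i.succ]

/-! ### Words -/

namespace OmegaWord

variable {Ω : Type v}

theorem ofFn_letter {n : ℕ} (w : OmegaWord Ω n) : List.ofFn w.letter = w.1 := by
  obtain ⟨l, rfl, h⟩ := w
  exact List.ofFn_get l

theorem length_ofFn_and_ne_nil {n : ℕ} (hn : n ≠ 0) (g : Fin n → Ω) :
    (List.ofFn g).length = n ∧ List.ofFn g ≠ [] :=
  ⟨List.length_ofFn, by simpa [List.ofFn_eq_nil_iff] using hn⟩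

/-- Words of length `n ≠ 0` are the sequences of `n` letters. -/
def letterEquiv {n : ℕ} (hn : n ≠ 0) : OmegaWord Ω n ≃ (Fin n → Ω) where
  toFun w := w.letter
  invFun g := ⟨List.ofFn g, length_ofFn_and_ne_nil hn g⟩
  left_inv w := Subtype.ext w.ofFn_letter
  right_inv g := List.ofFn_injective
    (ofFn_letter ⟨List.ofFn g, length_ofFn_and_ne_nil hn g⟩)

theorem letter_letterEquiv_symm {n : ℕ} (hn : n ≠ 0) (g : Fin n → Ω) (i : Fin n) :
    ((letterEquiv hn).symm g).letter i = g i :=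
  congrFun ((letterEquiv hn).apply_symm_apply g) i

instance isEmpty_zero : IsEmpty (OmegaWord Ω 0) := ⟨fun w => arity_ne_zero w rfl⟩

instance finite [Finite Ω] (n : ℕ) : Finite (OmegaWord Ω n) := by
  rcases eq_or_ne n 0 with rfl | hn
  · infer_instance
  · exact Finite.of_equiv _ (letterEquiv hn).symm

theorem coe_value [Semigroup Ω] {n : ℕ} (w : OmegaWord Ω n) :
    (w.value : WithOne Ω) = listProd w.1 :=
  coe_semigroupProd _ _

theorem letter_concat {n : ℕ} (hn : n ≠ 0) (k : Fin n → ℕ) (w : ∀ i, OmegaWord Ω (k i))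
    (m : Fin (∑ i, k i)) : (concat hn k w).letter m =
      (w (finSigmaFinEquiv.symm m).1).letter (finSigmaFinEquiv.symm m).2 := by
  have h : List.ofFn (concat hn k w).letter = List.ofFn fun m : Fin (∑ i, k i) =>
      (w (finSigmaFinEquiv.symm m).1).letter (finSigmaFinEquiv.symm m).2 := by
    rw [ofFn_letter, List.ofFn_finSigmaFinEquiv_symm k fun p => (w p.1).letter p.2]
    simp only [ofFn_letter]
    rfl
  exact congrFun (List.ofFn_injective h) m

theorem concat_injective {n : ℕ} (hn : n ≠ 0) (k : Fin n → ℕ) :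
    Function.Injective (concat (Ω := Ω) hn k) := by
  intro w w' h
  funext i
  refine (letterEquiv (w i).arity_ne_zero).injective (funext fun j => ?_)
  have := congrArg (fun u => u.letter (finSigmaFinEquiv (⟨i, j⟩ : Σ i, Fin (k i)))) h
  simp only [letter_concat] at this
  rwa [Equiv.symm_apply_apply] at this

theorem concat_surjective {n : ℕ} (hn : n ≠ 0) (k : Fin n → ℕ) (hk : ∀ i, k i ≠ 0) :
    Function.Surjective (concat (Ω := Ω) hn k) := by
  intro w
  refine ⟨fun i => (letterEquiv (hk i)).symm fun j => w.letter (finSigmaFinEquiv ⟨i, j⟩),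
    (letterEquiv w.arity_ne_zero).injective (funext fun m => ?_)⟩
  refine (letter_concat hn k _ m).trans ?_
  rw [letter_letterEquiv_symm, Sigma.eta, Equiv.apply_symm_apply]
  rfl

/-- The word whose letters are the products of given words. -/
def values [Semigroup Ω] {n : ℕ} (hn : n ≠ 0) {k : Fin n → ℕ} (w : ∀ i, OmegaWord Ω (k i)) :
    OmegaWord Ω n :=
  (letterEquiv hn).symm fun i => (w i).value

theorem eq_values_iff [Semigroup Ω] {n : ℕ} (hn : n ≠ 0) {k : Fin n → ℕ}
    (w : ∀ i, OmegaWord Ω (k i)) (a : OmegaWord Ω n) :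
    a = values hn w ↔ ∀ i, a.letter i = (w i).value := by
  rw [values, Equiv.eq_symm_apply]
  exact funext_iff

theorem value_values [Semigroup Ω] {n : ℕ} (hn : n ≠ 0) {k : Fin n → ℕ}
    (w : ∀ i, OmegaWord Ω (k i)) : (values hn w).value = (concat hn k w).value := by
  refine WithOne.coe_injective ?_
  rw [coe_value, coe_value]
  exact listProd_ofFn _ _ fun i => (w i).coe_value

theorem concat_concat {n : ℕ} (hn : n ≠ 0) (k : Fin n → ℕ) (hk : ∀ i, k i ≠ 0)
    (hs : ∑ i, k i ≠ 0) (l : (Σ i, Fin (k i)) → ℕ) (c : ∀ p, OmegaWord Ω (l p)) :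
    (concat hs (fun m => l (finSigmaFinEquiv.symm m))
      (fun m => c (finSigmaFinEquiv.symm m))).1 =
    (concat hn (fun i => ∑ j, l ⟨i, j⟩)
      (fun i => concat (hk i) (fun j => l ⟨i, j⟩) (fun j => c ⟨i, j⟩))).1 := by
  change (List.ofFn fun m => (c (finSigmaFinEquiv.symm m)).1).flatten =
    (List.ofFn fun i => (List.ofFn fun j => (c ⟨i, j⟩).1).flatten).flatten
  rw [List.ofFn_finSigmaFinEquiv_symm k fun p => (c p).1, List.flatten_flatten, List.map_ofFn]
  rfl

end OmegaWord

/-! ### The operad of words -/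

theorem Fintype.prod_ite_one_zero (K : Type u) [Field K] {ι : Type*} [Fintype ι] (p : ι → Prop) [∀ i, Decidable (p i)]
    [Decidable (∀ i, p i)] :
    (∏ i, if p i then (1 : K) else 0) = if ∀ i, p i then 1 else 0 := by
  split_ifs with h
  · exact Finset.prod_eq_one fun i _ => if_pos (h i)
  · obtain ⟨i, hi⟩ := not_forall.1 h
    exact Finset.prod_eq_zero (Finset.mem_univ i) (if_neg hi)

theorem prod_ite_letter_eq (K : Type u) [Field K] {Ω : Type v} [Semigroup Ω] [DecidableEq Ω] {n : ℕ} (hn : n ≠ 0) (k : Fin n → ℕ) (a : OmegaWord Ω n)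
    (w : ∀ i, OmegaWord Ω (k i)) :
    (∏ i, if a.letter i = (w i).value then (1 : K) else 0) =
      if a = OmegaWord.values hn w then 1 else 0 := by
  rw [Fintype.prod_ite_one_zero]
  exact if_congr (OmegaWord.eq_values_iff hn w a).symm rfl rfl

section WordOperad

variable (K : Type u) [Field K] {Ω : Type v} [Semigroup Ω] [Fintype Ω] [DecidableEq Ω]

/-- The coefficient of a word in an element of the operad of words. -/
def wordCoeff {n : ℕ} (w : OmegaWord Ω n) : (wordOperadData K Ω).obj n →ₗ[K] K :=
  Finsupp.lapply (M := K) (R := K) w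

variable {K}

theorem wordOperad_ext {n : ℕ} {x y : (wordOperadData K Ω).obj n}
    (h : ∀ w, wordCoeff K w x = wordCoeff K w y) : x = y :=
  Finsupp.ext h

theorem wordCoeff_wordElement {n : ℕ} (w w' : OmegaWord Ω n) :
    wordCoeff K w (wordElement K w') = if w' = w then 1 else 0 :=
  Finsupp.single_apply

theorem wordBasis_apply {n : ℕ} (w : OmegaWord Ω n) : wordBasis K Ω n w = wordElement K w :=
  congrFun (Finsupp.coe_basisSingleOne (R := K)) w

theorem wordOperadData_comp_wordElement {n : ℕ} (hn : n ≠ 0) (k : Fin n → ℕ) (a : OmegaWord Ω n)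
    (w : ∀ i, OmegaWord Ω (k i)) :
    (wordOperadData K Ω).comp k (wordElement K a) (fun i => wordElement K (w i)) =
      (∏ i, if a.letter i = (w i).value then (1 : K) else 0) •
        wordElement K (OmegaWord.concat hn k w) :=
  (OperadData.ofBasis_comp K _ _ _ k a w).trans (Finsupp.smul_single_one _ _).symm

theorem wordCoeff_concat_wordElement {n : ℕ} (hn : n ≠ 0) (k : Fin n → ℕ)
    (v w : ∀ i, OmegaWord Ω (k i)) :
    wordCoeff K (OmegaWord.concat hn k v) (wordElement K (OmegaWord.concat hn k w)) =
      ∏ i, wordCoeff K (v i) (wordElement K (w i)) := by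
  simp only [wordCoeff_wordElement]
  rw [Fintype.prod_ite_one_zero]
  exact if_congr ((OmegaWord.concat_injective hn k).eq_iff.trans funext_iff) rfl rfl

/-- Composition in the operad of words, in coordinates: the coefficient of a concatenation
`v₁…vₙ` in `a ∘ (b₁, …, bₙ)` is the product of those of the `vᵢ` in the `bᵢ` and of that, in `a`,
of the word formed by the products of the `vᵢ`. -/
theorem wordCoeff_comp {n : ℕ} (hn : n ≠ 0) (k : Fin n → ℕ) (a : (wordOperadData K Ω).obj n)
    (b : ∀ i, (wordOperadData K Ω).obj (k i)) (v : ∀ i, OmegaWord Ω (k i)) :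
    wordCoeff K (OmegaWord.concat hn k v) ((wordOperadData K Ω).comp k a b) =
      wordCoeff K (OmegaWord.values hn v) a * ∏ i, wordCoeff K (v i) (b i) := by
  have key₁ : ∀ (w : ∀ i, OmegaWord Ω (k i)) (a : (wordOperadData K Ω).obj n),
      wordCoeff K (OmegaWord.concat hn k v)
        ((wordOperadData K Ω).comp k a fun i => wordElement K (w i)) =
      wordCoeff K (OmegaWord.values hn v) a * ∏ i, wordCoeff K (v i) (wordElement K (w i)) := by
    intro w a
    have key : wordCoeff K (OmegaWord.concat hn k v) ∘ₗ
        (wordOperadData K Ω).compLeft k (fun i => wordElement K (w i)) =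
        (∏ i, wordCoeff K (v i) (wordElement K (w i))) • wordCoeff K (OmegaWord.values hn v) := by
      refine (wordBasis K Ω n).ext fun t => ?_
      rw [wordBasis_apply]
      change wordCoeff K (OmegaWord.concat hn k v) ((wordOperadData K Ω).comp k (wordElement K t)
        fun i => wordElement K (w i)) = _ * wordCoeff K _ (wordElement K t)
      rw [wordOperadData_comp_wordElement hn, map_smul, smul_eq_mul,
        wordCoeff_concat_wordElement, prod_ite_letter_eq K hn, wordCoeff_wordElement, mul_comm]
      by_cases hvw : w = v
      · rw [hvw]
      · have : ∏ i, wordCoeff K (v i) (wordElement K (w i)) = 0 := by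
          obtain ⟨i, hi⟩ := Function.ne_iff.1 hvw
          refine Finset.prod_eq_zero (Finset.mem_univ i) ?_
          rw [wordCoeff_wordElement, if_neg hi]
        rw [this, zero_mul, zero_mul]
    exact (congrArg (fun f : _ →ₗ[K] K => f a) key).trans (mul_comm _ _)
  have key : (wordCoeff K (OmegaWord.concat hn k v)).compMultilinearMap
      ((wordOperadData K Ω).comp k a) =
      wordCoeff K (OmegaWord.values hn v) a •
        (MultilinearMap.mkPiAlgebra K (Fin n) K).compLinearMap (fun i => wordCoeff K (v i)) := by
    refine Module.Basis.ext_multilinear (fun i => wordBasis K Ω (k i)) fun w => ?_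
    simp only [wordBasis_apply]
    exact key₁ w a
  exact congrArg (fun f : MultilinearMap K _ _ => f b) key

theorem wordCoeff_one (w : OmegaWord Ω 1) : wordCoeff K w (wordOperadData K Ω).one = 1 := by
  have h : (wordOperadData K Ω).one =
      ∑ α : Ω, wordElement K (⟨[α], rfl, List.cons_ne_nil _ _⟩ : OmegaWord Ω 1) := rfl
  obtain ⟨l, hl, hl'⟩ := w
  obtain ⟨b, rfl⟩ := List.length_eq_one_iff.1 hl
  rw [h, map_sum, Finset.sum_eq_single b]
  · rw [wordCoeff_wordElement, if_pos rfl]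
  · intro c _ hc
    rw [wordCoeff_wordElement, if_neg]
    simpa using hc
  · simp

theorem sigma_smul_wordElement_eq {m n : ℕ} {s : OmegaWord Ω m} {t : OmegaWord Ω n} {r r' : K}
    (hr : r = r') (h : s.1 = t.1) :
    (⟨m, r • wordElement K s⟩ : Σ n, (wordOperadData K Ω).obj n) = ⟨n, r' • wordElement K t⟩ := by
  obtain ⟨s, rfl, hs⟩ := s
  obtain ⟨t, rfl, ht⟩ := t
  dsimp only at h
  subst h hr
  rfl

theorem sigma_wordElement_eq {m n : ℕ} {s : OmegaWord Ω m} {t : OmegaWord Ω n} (h : s.1 = t.1) :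
    (⟨m, wordElement K s⟩ : Σ n, (wordOperadData K Ω).obj n) = ⟨n, wordElement K t⟩ := by
  simpa only [one_smul] using sigma_smul_wordElement_eq (r := (1 : K)) rfl h

/-- To compare two elements of arity `k₁ + ⋯ + kₙ`, it suffices to compare the coefficients of the
concatenations. -/
theorem wordOperad_ext_concat {n : ℕ} (hn : n ≠ 0) (k : Fin n → ℕ) (hk : ∀ i, k i ≠ 0)
    {x y : (wordOperadData K Ω).obj (∑ i, k i)}
    (h : ∀ v, wordCoeff K (OmegaWord.concat hn k v) x = wordCoeff K (OmegaWord.concat hn k v) y) :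
    x = y := by
  refine wordOperad_ext fun w => ?_
  obtain ⟨v, rfl⟩ := OmegaWord.concat_surjective hn k hk w
  exact h v

theorem wordOperadData_isOperad : (wordOperadData K Ω).IsOperad := by
  refine OperadData.isOperad_of_basis _ (wordBasis K Ω) ?_ ?_ ?_
  · intro n a
    simp only [wordBasis_apply]
    have h : (wordOperadData K Ω).comp (fun _ : Fin 1 => n) (wordOperadData K Ω).one
        (fun _ => wordElement K a) =
        wordElement K (OmegaWord.concat one_ne_zero (fun _ : Fin 1 => n) fun _ => a) := by
      refine wordOperad_ext_concat one_ne_zero _ (fun _ => a.arity_ne_zero) fun v => ?_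
      rw [wordCoeff_comp, wordCoeff_one, one_mul, wordCoeff_concat_wordElement]
    rw [h]
    refine sigma_wordElement_eq ?_
    change (List.ofFn fun _ : Fin 1 => a.1).flatten = a.1
    simp
  · intro n a
    simp only [wordBasis_apply]
    have hn := a.arity_ne_zero
    let c : Fin n → OmegaWord Ω 1 := fun i => ⟨[a.letter i], rfl, List.cons_ne_nil _ _⟩
    have hc : ∀ v : Fin n → OmegaWord Ω 1, c = v ↔ a = OmegaWord.values hn v := by
      intro v
      rw [OmegaWord.eq_values_iff, funext_iff]
      refine forall_congr' fun i => ?_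
      generalize v i = w
      obtain ⟨l, hl, hl'⟩ := w
      obtain ⟨b, rfl⟩ := List.length_eq_one_iff.1 hl
      simp only [c, Subtype.mk.injEq, List.cons.injEq, and_true]
      rfl
    have h : (wordOperadData K Ω).comp (fun _ : Fin n => 1) (wordElement K a)
        (fun _ => (wordOperadData K Ω).one) =
        wordElement K (OmegaWord.concat hn (fun _ : Fin n => 1) c) := by
      refine wordOperad_ext_concat hn _ (fun _ => one_ne_zero) fun v => ?_
      rw [wordCoeff_comp]
      simp only [wordCoeff_one, Finset.prod_const_one, mul_one, wordCoeff_wordElement]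
      exact if_congr ((hc v).symm.trans (OmegaWord.concat_injective hn _).eq_iff.symm) rfl rfl
    rw [h]
    refine sigma_wordElement_eq ?_
    change (List.ofFn fun i => [a.letter i]).flatten = a.1
    rw [show (List.ofFn fun i => [a.letter i]) = (List.ofFn a.letter).map fun x => [x] from
      by rw [List.map_ofFn]; rfl, a.ofFn_letter, ← List.flatMap_def, List.flatMap_singleton']
  · intro n k l a b c
    simp only [wordBasis_apply]
    have hn := a.arity_ne_zero
    have hk : ∀ i, k i ≠ 0 := fun i => (b i).arity_ne_zero
    have hs : ∑ i, k i ≠ 0 := (OmegaWord.concat hn k b).arity_ne_zero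
    have e : ∀ i, (wordOperadData K Ω).comp (fun j => l ⟨i, j⟩) (wordElement K (b i))
        (fun j => wordElement K (c ⟨i, j⟩)) = _ :=
      fun i => wordOperadData_comp_wordElement (hk i) _ _ _
    simp only [e]
    have hl : (wordOperadData K Ω).comp (fun m => l (finSigmaFinEquiv.symm m))
        ((wordOperadData K Ω).comp k (wordElement K a) fun i => wordElement K (b i))
        (fun m => wordElement K (c (finSigmaFinEquiv.symm m))) =
        ((∏ i, if a.letter i = (b i).value then (1 : K) else 0) *
          ∏ m, if (OmegaWord.concat hn k b).letter m = (c (finSigmaFinEquiv.symm m)).value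
            then (1 : K) else 0) •
          wordElement K (OmegaWord.concat hs (fun m => l (finSigmaFinEquiv.symm m))
            fun m => c (finSigmaFinEquiv.symm m)) := by
      rw [wordOperadData_comp_wordElement hn, map_smul, smul_apply,
        wordOperadData_comp_wordElement hs, smul_smul]
    have hr := ((wordOperadData K Ω).comp (fun i => ∑ j, l ⟨i, j⟩) (wordElement K a)).map_smul_univ
      (fun i => ∏ j, if (b i).letter j = (c ⟨i, j⟩).value then (1 : K) else 0)
      (fun i => wordElement K (OmegaWord.concat (hk i) (fun j => l ⟨i, j⟩) fun j => c ⟨i, j⟩))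
    rw [wordOperadData_comp_wordElement hn, smul_smul] at hr
    rw [hl]
    refine (sigma_smul_wordElement_eq ?_ (OmegaWord.concat_concat hn k hk hs l c)).trans
      (congrArg (Sigma.mk _) hr.symm)
    have hm : (∏ m, if (OmegaWord.concat hn k b).letter m =
        (c (finSigmaFinEquiv.symm m)).value then (1 : K) else 0) =
        ∏ i, ∏ j, if (b i).letter j = (c ⟨i, j⟩).value then (1 : K) else 0 := by
      simp only [OmegaWord.letter_concat]
      rw [Equiv.prod_comp finSigmaFinEquiv.symm fun p : Σ i, Fin (k i) =>
        if (b p.1).letter p.2 = (c p).value then (1 : K) else 0, Fintype.prod_sigma]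
    rw [hm, mul_comm, ← Finset.prod_mul_distrib, ← Finset.prod_mul_distrib]
    refine Finset.prod_congr rfl fun i _ => ?_
    rw [prod_ite_letter_eq K (hk i)]
    split_ifs with h₁ h₂ h₃ h₃ <;> simp_all [OmegaWord.value_values]

end WordOperad

/-! ### Morphisms of operads, kernels and images -/

/-- Morphisms of nonsymmetric operads. -/
structure NSOperad.Hom {K : Type u} [Field K] (O : NSOperad.{u, v} K) (O' : NSOperad.{u, w} K) where
  toLin : ∀ n, O.obj n →ₗ[K] O'.obj n
  map_one : toLin 1 O.one = O'.one
  map_comp : ∀ {n : ℕ} (k : Fin n → ℕ) (a : O.obj n) (b : ∀ i, O.obj (k i)),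
    toLin _ (O.comp k a b) = O'.comp k (toLin n a) (fun i => toLin (k i) (b i))

namespace NSOperad.Hom

variable {K : Type u} [Field K] {O : NSOperad.{u, v} K} {O' : NSOperad.{u, w} K}

/-- The kernel of a morphism of operads. -/
def ker (f : O.Hom O') : O.OperadIdeal where
  carrier n := LinearMap.ker (f.toLin n)
  comp_left k a b ha := by
    rw [LinearMap.mem_ker] at ha ⊢
    rw [f.map_comp, ha, map_zero, zero_apply]
  comp_right k a b i hb := by
    rw [LinearMap.mem_ker] at hb ⊢
    rw [f.map_comp]
    exact (O'.comp k _).map_coord_zero i hb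

/-- The image of a morphism of operads. -/
def range (f : O.Hom O') : O'.Suboperad where
  carrier n := LinearMap.range (f.toLin n)
  one_mem := ⟨O.one, f.map_one⟩
  comp_mem k a b ha hb := by
    obtain ⟨a, rfl⟩ := ha
    choose b' hb using hb
    obtain rfl := funext hb
    exact ⟨O.comp k a b', f.map_comp k a b'⟩

/-- The first isomorphism theorem for operads. -/
def quotientIsoRange (f : O.Hom O') (J : O.OperadIdeal) (h : ∀ n, J.carrier n = f.ker.carrier n) :
    NSOperad.Iso J.quotient f.range.toNSOperad where
  equiv n := (Submodule.quotEquivOfEq _ _ (h n)).trans (f.toLin n).quotKerEquivRange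
  map_one := Subtype.ext f.map_one
  map_comp {n} k a b := by
    obtain ⟨a, rfl⟩ := (J.carrier n).mkQ_surjective a
    choose b' hb using fun i => (J.carrier (k i)).mkQ_surjective (b i)
    obtain rfl : (fun i => (J.carrier (k i)).mkQ (b' i)) = b := funext hb
    refine (congrArg _ (J.quotientData_comp_mk k a b')).trans (Subtype.ext ?_)
    exact f.map_comp k a b'

end NSOperad.Hom

/-! ### Words accepted by a tree -/

section Accepts

variable {Ω : Type v} [Semigroup Ω]

/-- A tree decorated by pairs of elements of `Ω` accepts a word, whose letters are placed on its
leaves, if at each vertex decorated by `(α, β)` the letters on the left of the vertex have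
product `α` and those on its right have product `β`. -/
def Accepts : BinaryTree (Ω × Ω) → List Ω → Prop
  | .nil, w => w.length = 1
  | .node x l r, w =>
    ((x.1 : WithOne Ω) = listProd (w.take l.numLeaves) ∧
      (x.2 : WithOne Ω) = listProd (w.drop l.numLeaves)) ∧
    Accepts l (w.take l.numLeaves) ∧ Accepts r (w.drop l.numLeaves)

theorem accepts_node_append {x : Ω × Ω} {l r : BinaryTree (Ω × Ω)} {u v : List Ω}
    (hu : u.length = l.numLeaves) :
    Accepts (.node x l r) (u ++ v) ↔
      ((x.1 : WithOne Ω) = listProd u ∧ (x.2 : WithOne Ω) = listProd v) ∧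
        Accepts l u ∧ Accepts r v := by
  rw [Accepts, List.take_left' hu, List.drop_left' hu]

theorem Accepts.length_eq {t : BinaryTree (Ω × Ω)} {w : List Ω} (h : Accepts t w) :
    w.length = t.numLeaves := by
  induction t generalizing w with
  | nil => exact h
  | node x l r hl hr =>
    obtain ⟨-, h₁, h₂⟩ := h
    rw [← List.take_append_drop l.numLeaves w, List.length_append, hl h₁, hr h₂]
    rfl

theorem accepts_graft (t : BinaryTree (Ω × Ω)) (f : Fin t.numLeaves → BinaryTree (Ω × Ω))
    (u : Fin t.numLeaves → Ω) (L : Fin t.numLeaves → List Ω)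
    (hL : ∀ i, (L i).length = (f i).numLeaves) (hu : ∀ i, (u i : WithOne Ω) = listProd (L i)) :
    Accepts (graft t f) (List.ofFn L).flatten ↔
      Accepts t (List.ofFn u) ∧ ∀ i, Accepts (f i) (L i) := by
  induction t with
  | nil =>
    have h : (List.ofFn L).flatten = L (0 : Fin 1) := List.append_nil _
    rw [h]
    exact ⟨fun h => ⟨rfl, fun i => by rwa [Subsingleton.elim (α := Fin 1) i 0]⟩, fun h => h.2 _⟩
  | node x l r hl hr =>
    have eL : List.ofFn L = List.ofFn (fun i => L (Fin.castAdd r.numLeaves i)) ++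
      List.ofFn (fun i => L (Fin.natAdd l.numLeaves i)) := List.ofFn_add
    have eu : List.ofFn u = List.ofFn (fun i => u (Fin.castAdd r.numLeaves i)) ++
      List.ofFn (fun i => u (Fin.natAdd l.numLeaves i)) := List.ofFn_add
    have hlen : (List.ofFn fun i => L (Fin.castAdd r.numLeaves i)).flatten.length =
        (graft l fun i => f (Fin.castAdd r.numLeaves i)).numLeaves := by
      rw [numLeaves_graft, List.length_flatten, List.map_ofFn, List.sum_ofFn]
      exact Finset.sum_congr rfl fun i _ => hL _
    have hall : (∀ i, Accepts (f i) (L i)) ↔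
        (∀ i, Accepts (f (Fin.castAdd r.numLeaves i)) (L (Fin.castAdd r.numLeaves i))) ∧
        ∀ i, Accepts (f (Fin.natAdd l.numLeaves i)) (L (Fin.natAdd l.numLeaves i)) :=
      ⟨fun h => ⟨fun i => h _, fun i => h _⟩, fun h => Fin.addCases h.1 h.2⟩
    rw [eL, eu, List.flatten_append, graft, accepts_node_append hlen,
      accepts_node_append List.length_ofFn, hall,
      hl _ (fun i => u (Fin.castAdd r.numLeaves i)) _ (fun i => hL _) (fun i => hu _),
      hr _ (fun i => u (Fin.natAdd l.numLeaves i)) _ (fun i => hL _) (fun i => hu _),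
      listProd_ofFn (fun i => u (Fin.castAdd r.numLeaves i)) _ (fun i => hu _),
      listProd_ofFn (fun i => u (Fin.natAdd l.numLeaves i)) _ (fun i => hu _)]
    tauto

end Accepts

/-! ### The morphism from trees to words -/

section TreeEval

variable (K : Type u) [Field K] {Ω : Type v} [Semigroup Ω] [Fintype Ω] [DecidableEq Ω]

open Classical in
/-- The sum of the words of length `n` accepted by a tree. -/
def acceptedSum {n : ℕ} (t : PlanarTree (Ω × Ω) n) : (wordOperadData K Ω).obj n :=
  (Finsupp.equivFunOnFinite.symm fun w => if Accepts t.1 w.1 then 1 else 0 : OmegaWord Ω n →₀ K)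

/-- The linear map sending a tree to the sum of the words which it accepts. -/
def treeEval (n : ℕ) : (freeOperadData K (Ω × Ω)).obj n →ₗ[K] (wordOperadData K Ω).obj n :=
  (treeBasis K (Ω × Ω) n).constr K (acceptedSum K)

variable {K}

open Classical in
theorem wordCoeff_treeEval {n : ℕ} (t : PlanarTree (Ω × Ω) n) (w : OmegaWord Ω n) :
    wordCoeff K w (treeEval K n (treeElement K t)) = if Accepts t.1 w.1 then 1 else 0 := by
  rw [← treeBasis_apply, treeEval, Module.Basis.constr_basis]
  rfl

theorem planarTree_arity_ne_zero {X : Type v} {n : ℕ} (t : PlanarTree X n) : n ≠ 0 := by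
  obtain ⟨t, rfl⟩ := t
  exact t.numLeaves_pos.ne'

theorem treeEval_comp_treeElement {n : ℕ} (k : Fin n → ℕ) (t : PlanarTree (Ω × Ω) n)
    (s : ∀ i, PlanarTree (Ω × Ω) (k i)) :
    treeEval K _ (treeElement K (PlanarTree.graft k t s)) =
      (wordOperadData K Ω).comp k (treeEval K n (treeElement K t))
        (fun i => treeEval K (k i) (treeElement K (s i))) := by
  classical
  have hn := planarTree_arity_ne_zero t
  refine wordOperad_ext_concat hn k (fun i => planarTree_arity_ne_zero (s i)) fun v => ?_
  rw [wordCoeff_comp, wordCoeff_treeEval]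
  simp only [wordCoeff_treeEval]
  rw [Fintype.prod_ite_one_zero, ite_zero_mul_ite_zero, mul_one]
  refine if_congr ?_ rfl rfl
  obtain ⟨t, rfl⟩ := t
  exact accepts_graft t (fun i => (s i).1) (fun i => (v i).value) (fun i => (v i).1)
    (fun i => (v i).2.1.trans (s i).2.symm) (fun i => (v i).coe_value)

/-- The tree without vertex, which is the unit of the free operad. -/
def emptyTree (X : Type v) : PlanarTree X 1 := ⟨.nil, rfl⟩

theorem treeEval_emptyTree : treeEval K 1 (treeElement K (emptyTree (Ω × Ω))) =
    (wordOperadData K Ω).one := by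
  classical
  refine wordOperad_ext fun w => ?_
  rw [wordCoeff_one, wordCoeff_treeEval]
  exact if_pos w.2.1

theorem treeEval_comp {n : ℕ} (k : Fin n → ℕ) (a : (freeOperadData K (Ω × Ω)).obj n)
    (b : ∀ i, (freeOperadData K (Ω × Ω)).obj (k i)) :
    treeEval K _ ((freeOperadData K (Ω × Ω)).comp k a b) =
      (wordOperadData K Ω).comp k (treeEval K n a) (fun i => treeEval K (k i) (b i)) := by
  have key₁ : ∀ (s : ∀ i, PlanarTree (Ω × Ω) (k i)) (a : (freeOperadData K (Ω × Ω)).obj n),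
      treeEval K _ ((freeOperadData K (Ω × Ω)).comp k a fun i => treeElement K (s i)) =
      (wordOperadData K Ω).comp k (treeEval K n a)
        (fun i => treeEval K (k i) (treeElement K (s i))) := by
    intro s a
    have key : treeEval K _ ∘ₗ
        (freeOperadData K (Ω × Ω)).compLeft k (fun i => treeElement K (s i)) =
        (wordOperadData K Ω).compLeft k (fun i => treeEval K (k i) (treeElement K (s i))) ∘ₗ
          treeEval K n := by
      refine (treeBasis K (Ω × Ω) n).ext fun t => ?_
      rw [treeBasis_apply]
      exact (congrArg _ (freeOperadData_comp K k t s)).trans (treeEval_comp_treeElement k t s)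
    exact congrArg (fun f : _ →ₗ[K] _ => f a) key
  have key : (treeEval K _).compMultilinearMap ((freeOperadData K (Ω × Ω)).comp k a) =
      ((wordOperadData K Ω).comp k (treeEval K n a)).compLinearMap
        (fun i => treeEval K (k i)) := by
    refine Module.Basis.ext_multilinear (fun i => treeBasis K (Ω × Ω) (k i)) fun s => ?_
    simp only [treeBasis_apply]
    exact key₁ s a
  exact congrArg (fun f : MultilinearMap K _ _ => f b) key

variable (K Ω) in
/-- The operad of words. -/
def wordOperad : NSOperad.{u, max u v} K := ⟨wordOperadData K Ω, wordOperadData_isOperad⟩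

variable (K Ω) in
/-- The morphism of operads sending a tree to the sum of the words which it accepts; the
generator `(α, β)` is sent to the word `αβ`. -/
def treeEvalHom : (freeOperad K (Ω × Ω)).Hom (wordOperad K Ω) where
  toLin := treeEval K
  map_one := treeEval_emptyTree
  map_comp := treeEval_comp

end TreeEval

/-! ### Congruence of trees modulo an operadic ideal -/

section TreeCongr

variable {K : Type u} [Field K] {X : Type v}

/-- A tree belongs to an operadic ideal of the free operad. -/
def TreeMem (J : (freeOperad K X).OperadIdeal) (t : BinaryTree X) : Prop :=
  treeElement K ⟨t, rfl⟩ ∈ J.carrier t.numLeaves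

/-- Two trees have the same number of leaves and are congruent modulo an operadic ideal of the free
operad. -/
def TreeCongr (J : (freeOperad K X).OperadIdeal) (s t : BinaryTree X) : Prop :=
  ∃ h : s.numLeaves = t.numLeaves,
    treeElement K ⟨s, h⟩ - treeElement K ⟨t, rfl⟩ ∈ J.carrier t.numLeaves

variable {J : (freeOperad K X).OperadIdeal}

theorem treeMem_iff {n : ℕ} (t : PlanarTree X n) :
    TreeMem J t.1 ↔ treeElement K t ∈ J.carrier n := by
  obtain ⟨t, rfl⟩ := t
  rfl

theorem treeCongr_iff {n : ℕ} (s t : PlanarTree X n) :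
    TreeCongr J s.1 t.1 ↔ treeElement K s - treeElement K t ∈ J.carrier n := by
  obtain ⟨t, rfl⟩ := t
  exact ⟨fun h => h.2, fun h => ⟨s.2, h⟩⟩

theorem TreeCongr.refl (t : BinaryTree X) : TreeCongr J t t :=
  ⟨rfl, by rw [sub_self]; exact (J.carrier _).zero_mem⟩

theorem TreeCongr.trans {s t u : BinaryTree X} (h : TreeCongr J s t) (h' : TreeCongr J t u) :
    TreeCongr J s u := by
  have hs := h.1.trans h'.1
  have h₁ := (treeCongr_iff (J := J) ⟨s, hs⟩ ⟨t, h'.1⟩).1 h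
  have h₂ := (treeCongr_iff (J := J) ⟨t, h'.1⟩ ⟨u, rfl⟩).1 h'
  exact ⟨hs, (sub_add_sub_cancel (treeElement K (⟨s, hs⟩ : PlanarTree X _))
    (treeElement K ⟨t, h'.1⟩) (treeElement K ⟨u, rfl⟩)) ▸ (J.carrier _).add_mem h₁ h₂⟩

theorem TreeCongr.treeMem {s t : BinaryTree X} (h : TreeCongr J s t) (ht : TreeMem J t) :
    TreeMem J s := by
  refine (treeMem_iff (J := J) ⟨s, h.1⟩).2 ?_
  exact (sub_add_cancel (treeElement K (⟨s, h.1⟩ : PlanarTree X _)) (treeElement K ⟨t, rfl⟩)) ▸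
    (J.carrier _).add_mem h.2 ht

theorem TreeMem.graft_left {n : ℕ} {t : PlanarTree X n} (ht : treeElement K t ∈ J.carrier n)
    (f : Fin n → BinaryTree X) : TreeMem J (graft t.1 fun i => f (Fin.cast t.2 i)) := by
  have h := J.comp_left (fun i => (f i).numLeaves) (treeElement K t)
    (fun i => treeElement K ⟨f i, rfl⟩) ht
  exact (treeMem_iff _).2 ((freeOperadData_comp K _ t fun i => ⟨f i, rfl⟩) ▸ h)

theorem TreeCongr.graft_left {n : ℕ} {s t : PlanarTree X n}
    (h : treeElement K s - treeElement K t ∈ J.carrier n) (f : Fin n → BinaryTree X) :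
    TreeCongr J (graft s.1 fun i => f (Fin.cast s.2 i))
      (graft t.1 fun i => f (Fin.cast t.2 i)) := by
  have h := J.comp_left (fun i => (f i).numLeaves) (treeElement K s - treeElement K t)
    (fun i => treeElement K ⟨f i, rfl⟩) h
  have e : (freeOperadData K X).comp (fun i => (f i).numLeaves) (treeElement K s - treeElement K t)
      (fun i => treeElement K ⟨f i, rfl⟩) =
      treeElement K (PlanarTree.graft _ s fun i => ⟨f i, rfl⟩) -
        treeElement K (PlanarTree.graft _ t fun i => ⟨f i, rfl⟩) := by
    rw [← freeOperadData_comp, ← freeOperadData_comp, map_sub, sub_apply]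
  exact (treeCongr_iff _ _).2 (e ▸ h)

theorem TreeMem.graft_right {n : ℕ} (t : PlanarTree X n) (f : Fin n → BinaryTree X) (i : Fin n)
    (hi : TreeMem J (f i)) : TreeMem J (graft t.1 fun i => f (Fin.cast t.2 i)) := by
  have h := J.comp_right (fun i => (f i).numLeaves) (treeElement K t)
    (fun i => treeElement K ⟨f i, rfl⟩) i hi
  exact (treeMem_iff _).2 ((freeOperadData_comp K _ t fun i => ⟨f i, rfl⟩) ▸ h)

theorem TreeCongr.graft_right {n : ℕ} (t : PlanarTree X n) (f g : Fin n → BinaryTree X)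
    (h : ∀ i, TreeCongr J (f i) (g i)) :
    TreeCongr J (graft t.1 fun i => f (Fin.cast t.2 i))
      (graft t.1 fun i => g (Fin.cast t.2 i)) := by
  have h' := J.comp_sub_mem (fun i => (g i).numLeaves) (treeElement K t)
    (fun i => treeElement K ⟨f i, (h i).1⟩) (fun i => treeElement K ⟨g i, rfl⟩) fun i => (h i).2
  have e : (freeOperadData K X).comp (fun i => (g i).numLeaves) (treeElement K t)
      (fun i => treeElement K ⟨f i, (h i).1⟩) -
      (freeOperadData K X).comp (fun i => (g i).numLeaves) (treeElement K t)
      (fun i => treeElement K ⟨g i, rfl⟩) =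
      treeElement K (PlanarTree.graft _ t fun i => ⟨f i, (h i).1⟩) -
        treeElement K (PlanarTree.graft _ t fun i => ⟨g i, rfl⟩) := by
    rw [freeOperadData_comp, freeOperadData_comp]
  exact (treeCongr_iff _ _).2 (e ▸ h')

theorem TreeCongr.node (x : X) {l l' r r' : BinaryTree X} (hl : TreeCongr J l l')
    (hr : TreeCongr J r r') : TreeCongr J (.node x l r) (.node x l' r') :=
  TreeCongr.graft_right (.corolla x) ![l, r] ![l', r'] (Fin.forall_fin_two.2 ⟨hl, hr⟩)

theorem TreeMem.node_left (x : X) {l : BinaryTree X} (hl : TreeMem J l) (r : BinaryTree X) :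
    TreeMem J (.node x l r) :=
  TreeMem.graft_right (.corolla x) ![l, r] 0 hl

theorem TreeMem.node_right (x : X) (l : BinaryTree X) {r : BinaryTree X} (hr : TreeMem J r) :
    TreeMem J (.node x l r) :=
  TreeMem.graft_right (.corolla x) ![l, r] 1 hr

end TreeCongr

/-! ### The relations of the Koszul dual -/

section KoszulDual

variable {K : Type u} [Field K]

theorem treeBasis_repr_treeElement {X : Type v} [DecidableEq X] {n : ℕ} (s t : PlanarTree X n)
    [Decidable (s = t)] :
    (treeBasis K X n).repr (treeElement K s) t = if s = t then 1 else 0 := by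
  rw [← treeBasis_apply, Module.Basis.repr_self, Finsupp.single_apply]

theorem koszulPairing_comm {X : Type v} [Fintype X] (f g : (freeOperad K X).obj 3) :
    koszulPairing f g = koszulPairing g f := by
  simp only [koszulPairing]
  exact Finset.sum_congr rfl fun x _ => Finset.sum_congr rfl fun y _ => by ring

theorem circOne_inj {X : Type v} {x y x' y' : X} :
    PlanarTree.circOne x y = PlanarTree.circOne x' y' ↔ x = x' ∧ y = y' := by
  rw [Subtype.ext_iff]
  change BinaryTree.node _ _ _ = BinaryTree.node _ _ _ ↔ _
  simp

theorem circTwo_inj {X : Type v} {x y x' y' : X} :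
    PlanarTree.circTwo x y = PlanarTree.circTwo x' y' ↔ x = x' ∧ y = y' := by
  rw [Subtype.ext_iff]
  change BinaryTree.node _ _ _ = BinaryTree.node _ _ _ ↔ _
  simp

theorem circOne_ne_circTwo {X : Type v} {x y x' y' : X} :
    PlanarTree.circOne x y ≠ PlanarTree.circTwo x' y' := by
  rw [Ne, Subtype.ext_iff]
  change ¬BinaryTree.node _ _ _ = BinaryTree.node _ _ _
  simp

theorem koszulPairing_circOne {X : Type v} [Fintype X] (f : (freeOperad K X).obj 3) (x y : X) :
    koszulPairing f (treeElement K (.circOne x y)) = (treeBasis K X 3).repr f (.circOne x y) := by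
  classical
  simp only [koszulPairing]
  rw [Finset.sum_eq_single x, Finset.sum_eq_single y]
  · simp only [treeBasis_repr_treeElement, circOne_ne_circTwo, if_true, if_false]
    ring
  · intro y' _ hy
    simp only [treeBasis_repr_treeElement, circOne_ne_circTwo, circOne_inj, hy.symm, and_false,
      if_false]
    ring
  · simp
  · intro x' _ hx
    refine Finset.sum_eq_zero fun y' _ => ?_
    simp only [treeBasis_repr_treeElement, circOne_ne_circTwo, circOne_inj, hx.symm, false_and,
      if_false]
    ring
  · simp

theorem koszulPairing_circTwo {X : Type v} [Fintype X] (f : (freeOperad K X).obj 3) (x y : X) :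
    koszulPairing f (treeElement K (.circTwo x y)) =
      -(treeBasis K X 3).repr f (.circTwo x y) := by
  classical
  simp only [koszulPairing]
  rw [Finset.sum_eq_single x, Finset.sum_eq_single y]
  · simp only [treeBasis_repr_treeElement, circOne_ne_circTwo.symm, if_true, if_false]
    ring
  · intro y' _ hy
    simp only [treeBasis_repr_treeElement, circOne_ne_circTwo.symm, circTwo_inj, hy.symm,
      and_false, if_false]
    ring
  · simp
  · intro x' _ hx
    refine Finset.sum_eq_zero fun y' _ => ?_
    simp only [treeBasis_repr_treeElement, circOne_ne_circTwo.symm, circTwo_inj, hx.symm,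
      false_and, if_false]
    ring
  · simp

variable {Ω : Type v} [Semigroup Ω]

/-- The monomial `*_(αβ,γ) ∘₁ *_(α,β)`, the first of the two trees accepting the word `αβγ`. -/
def leftTree (α β γ : Ω) : PlanarTree (Ω × Ω) 3 := .circOne (α * β, γ) (α, β)

/-- The monomial `*_(α,βγ) ∘₂ *_(β,γ)`, the second of the two trees accepting the word `αβγ`. -/
def rightTree (α β γ : Ω) : PlanarTree (Ω × Ω) 3 := .circTwo (α, β * γ) (β, γ)

theorem BinaryTree.eq_nil_of_numLeaves_le_one {X : Type v} {t : BinaryTree X}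
    (h : t.numLeaves ≤ 1) : t = .nil := by
  rcases t with _ | ⟨x, l, r⟩
  · rfl
  · have := l.numLeaves_pos
    have := r.numLeaves_pos
    simp only [BinaryTree.numLeaves] at h
    omega

theorem eq_circOne_or_circTwo {X : Type v} (t : PlanarTree X 3) :
    (∃ x y, t = .circOne x y) ∨ ∃ x y, t = .circTwo x y := by
  obtain ⟨t, ht⟩ := t
  rcases t with _ | ⟨x, l, r⟩
  · simp [BinaryTree.numLeaves] at ht
  have hl := l.numLeaves_pos
  have hr := r.numLeaves_pos
  rcases l with _ | ⟨y, l₁, l₂⟩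
  · rcases r with _ | ⟨y, r₁, r₂⟩
    · simp [BinaryTree.numLeaves] at ht
    have h₁ := r₁.numLeaves_pos
    have h₂ := r₂.numLeaves_pos
    simp only [BinaryTree.numLeaves] at ht
    obtain rfl := BinaryTree.eq_nil_of_numLeaves_le_one (t := r₁) (by omega)
    obtain rfl := BinaryTree.eq_nil_of_numLeaves_le_one (t := r₂) (by omega)
    exact Or.inr ⟨x, y, rfl⟩
  · have h₁ := l₁.numLeaves_pos
    have h₂ := l₂.numLeaves_pos
    simp only [BinaryTree.numLeaves] at ht
    obtain rfl := BinaryTree.eq_nil_of_numLeaves_le_one (t := l₁) (by omega)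
    obtain rfl := BinaryTree.eq_nil_of_numLeaves_le_one (t := l₂) (by omega)
    obtain rfl := BinaryTree.eq_nil_of_numLeaves_le_one (t := r) (by omega)
    exact Or.inl ⟨x, y, rfl⟩

/-- A word of length `3` is accepted by exactly two trees. -/
theorem accepts_iff_of_length_three (t : PlanarTree (Ω × Ω) 3) (α β γ : Ω) :
    Accepts t.1 [α, β, γ] ↔ t = leftTree α β γ ∨ t = rightTree α β γ := by
  rcases eq_circOne_or_circTwo t with ⟨x, y, rfl⟩ | ⟨x, y, rfl⟩
  · simp only [leftTree, rightTree, circOne_inj, circOne_ne_circTwo, or_false, Prod.ext_iff]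
    simp [PlanarTree.circOne, Accepts, BinaryTree.numLeaves, listProd_cons, ← WithOne.coe_mul]
  · simp only [leftTree, rightTree, circTwo_inj, circOne_ne_circTwo.symm, false_or, Prod.ext_iff]
    simp [PlanarTree.circTwo, Accepts, BinaryTree.numLeaves, listProd_cons, ← WithOne.coe_mul]

variable [Fintype Ω]

theorem koszulPairing_relation (f : (freeOperad K (Ω × Ω)).obj 3) (α β γ : Ω) :
    koszulPairing f (treeElement K (leftTree α β γ) - treeElement K (rightTree α β γ)) =
      (treeBasis K (Ω × Ω) 3).repr f (leftTree α β γ) +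
        (treeBasis K (Ω × Ω) 3).repr f (rightTree α β γ) := by
  have e : treeElement K (leftTree α β γ) - treeElement K (rightTree α β γ) =
    treeElement K (leftTree α β γ) + (-1 : K) • treeElement K (rightTree α β γ) := by
    rw [neg_one_smul, sub_eq_add_neg]
  rw [e]
  refine (koszulPairing_comm f _).trans ?_
  refine (koszulPairing_add_left (X := Ω × Ω) _ _ f).trans ?_
  refine (congrArg (_ + ·) (koszulPairing_smul_left (X := Ω × Ω) _ _ f)).trans ?_
  refine (congrArg₂ (fun a b => a + -1 * b)
    ((koszulPairing_comm _ f).trans (koszulPairing_circOne f _ _))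
    ((koszulPairing_comm _ f).trans (koszulPairing_circTwo f _ _))).trans ?_
  simp only [neg_mul_neg, one_mul]
  rfl

/-- The plus sign comes from the two minus signs, in the relation and in the pairing. -/
theorem mem_koszulDual_rel_iff (f : (freeOperad K (Ω × Ω)).obj 3) :
    f ∈ (twoParameterAs K Ω).koszulDual.rel ↔ ∀ α β γ : Ω,
      (treeBasis K (Ω × Ω) 3).repr f (leftTree α β γ) +
        (treeBasis K (Ω × Ω) 3).repr f (rightTree α β γ) = 0 := by
  constructor
  · intro h α β γ
    rw [← koszulPairing_relation]
    exact h _ (Submodule.subset_span ⟨(α, β, γ), rfl⟩)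
  · intro h g hg
    rw [koszulPairing_comm]
    refine Submodule.span_induction (p := fun g _ => koszulPairing g f = 0) ?_ ?_ ?_ ?_ hg
    · rintro _ ⟨⟨α, β, γ⟩, rfl⟩
      refine (koszulPairing_comm _ f).trans ?_
      exact (koszulPairing_relation f α β γ).trans (h α β γ)
    · simpa using koszulPairing_smul_left (0 : K) (0 : (freeOperad K (Ω × Ω)).obj 3) f
    · intro x y _ _ hx hy
      rw [koszulPairing_add_left, hx, hy, add_zero]
    · intro r x _ hx
      rw [koszulPairing_smul_left, hx, mul_zero]

theorem circOne_mem_koszulDual_rel {x y : Ω × Ω} (h : x.1 ≠ y.1 * y.2) :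
    treeElement K (PlanarTree.circOne x y) ∈ (twoParameterAs K Ω).koszulDual.rel := by
  classical
  refine (mem_koszulDual_rel_iff _).2 fun α β γ => ?_
  rw [treeBasis_repr_treeElement, treeBasis_repr_treeElement, if_neg, if_neg, add_zero]
  · exact circOne_ne_circTwo
  · rw [leftTree, circOne_inj]
    rintro ⟨rfl, rfl⟩
    exact h rfl

theorem circTwo_mem_koszulDual_rel {x y : Ω × Ω} (h : x.2 ≠ y.1 * y.2) :
    treeElement K (PlanarTree.circTwo x y) ∈ (twoParameterAs K Ω).koszulDual.rel := by
  classical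
  refine (mem_koszulDual_rel_iff _).2 fun α β γ => ?_
  rw [treeBasis_repr_treeElement, treeBasis_repr_treeElement, if_neg, if_neg, add_zero]
  · rw [rightTree, circTwo_inj]
    rintro ⟨rfl, rfl⟩
    exact h rfl
  · exact circOne_ne_circTwo.symm

theorem leftTree_sub_rightTree_mem_koszulDual_rel (α β γ : Ω) :
    treeElement K (leftTree α β γ) - treeElement K (rightTree α β γ) ∈
      (twoParameterAs K Ω).koszulDual.rel := by
  classical
  refine (mem_koszulDual_rel_iff _).2 fun α' β' γ' => ?_
  have e : (treeBasis K (Ω × Ω) 3).repr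
      (treeElement K (leftTree α β γ) - treeElement K (rightTree α β γ)) =
      (treeBasis K (Ω × Ω) 3).repr (treeElement K (leftTree α β γ)) -
        (treeBasis K (Ω × Ω) 3).repr (treeElement K (rightTree α β γ)) := map_sub _ _ _
  rw [e]
  simp only [Finsupp.sub_apply, treeBasis_repr_treeElement]
  have h₁ : leftTree α β γ ≠ rightTree α' β' γ' := circOne_ne_circTwo
  have h₂ : rightTree α β γ ≠ leftTree α' β' γ' := circOne_ne_circTwo.symm
  have h₃ : leftTree α β γ = leftTree α' β' γ' ↔ rightTree α β γ = rightTree α' β' γ' := by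
    simp only [leftTree, rightTree, circOne_inj, circTwo_inj, Prod.mk.injEq]
    constructor
    · rintro ⟨⟨-, rfl⟩, rfl, rfl⟩
      exact ⟨⟨rfl, rfl⟩, rfl, rfl⟩
    · rintro ⟨⟨rfl, -⟩, rfl, rfl⟩
      exact ⟨⟨rfl, rfl⟩, rfl, rfl⟩
  simp only [h₁, h₂, h₃, if_false]
  ring

theorem koszulDual_rel_le_ker [DecidableEq Ω] :
    ((twoParameterAs K Ω).koszulDual.rel : Set ((freeOperad K (Ω × Ω)).obj 3)) ⊆
      (treeEvalHom K Ω).ker.carrier 3 := by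
  classical
  intro f hf
  suffices h : treeEval K (Ω := Ω) 3 f = 0 from h
  refine wordOperad_ext fun w => ?_
  obtain ⟨l, hl, hl'⟩ := w
  obtain ⟨α, β, γ, rfl⟩ := List.length_eq_three.1 hl
  have key : wordCoeff K (⟨[α, β, γ], hl, hl'⟩ : OmegaWord Ω 3) ∘ₗ treeEval K 3 =
      (treeBasis K (Ω × Ω) 3).coord (leftTree α β γ) +
        (treeBasis K (Ω × Ω) 3).coord (rightTree α β γ) := by
    refine (treeBasis K (Ω × Ω) 3).ext fun t => ?_
    rw [treeBasis_apply, LinearMap.comp_apply, wordCoeff_treeEval, LinearMap.add_apply,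
      Module.Basis.coord_apply, Module.Basis.coord_apply, treeBasis_repr_treeElement,
      treeBasis_repr_treeElement, accepts_iff_of_length_three]
    by_cases h : t = leftTree α β γ
    · have h₁ : leftTree α β γ ≠ rightTree α β γ := circOne_ne_circTwo
      simp [h, h₁]
    · simp [h]
  refine (congrArg (fun g : (freeOperadData K (Ω × Ω)).obj 3 →ₗ[K] K => g f) key).trans ?_
  rw [map_zero]
  exact (mem_koszulDual_rel_iff f).1 hf α β γ

end KoszulDual

/-! ### Right combs as normal forms -/

section RightComb

variable {Ω : Type v} [Semigroup Ω]

/-- The product in `Ω` of the word `a :: l`. -/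
def prodFrom (a : Ω) (l : List Ω) : Ω := semigroupProd (a :: l) (List.cons_ne_nil a l)

theorem coe_prodFrom (a : Ω) (l : List Ω) : ((prodFrom a l : Ω) : WithOne Ω) = listProd (a :: l) :=
  coe_semigroupProd _ _

theorem prodFrom_append_cons (a c : Ω) (l m : List Ω) :
    prodFrom a (l ++ c :: m) = prodFrom a l * prodFrom c m := by
  refine WithOne.coe_injective ?_
  rw [WithOne.coe_mul, coe_prodFrom, coe_prodFrom, coe_prodFrom, ← List.cons_append,
    listProd_append]

theorem prodFrom_cons (a b : Ω) (l : List Ω) : prodFrom a (b :: l) = a * prodFrom b l :=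
  prodFrom_append_cons a b [] l

/-- The right comb accepting the word `a :: l`. -/
def rightComb : Ω → List Ω → BinaryTree (Ω × Ω)
  | _, [] => .nil
  | a, b :: l => .node (a, prodFrom b l) .nil (rightComb b l)

theorem numLeaves_rightComb (a : Ω) (l : List Ω) :
    (rightComb a l).numLeaves = l.length + 1 := by
  induction l generalizing a with
  | nil => rfl
  | cons b l ih => rw [rightComb, BinaryTree.numLeaves, ih, List.length_cons, add_comm]; rfl

theorem accepts_rightComb_self (a : Ω) (l : List Ω) : Accepts (rightComb a l) (a :: l) := by
  induction l generalizing a with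
  | nil => rfl
  | cons b l ih =>
    rw [rightComb, ← List.singleton_append, accepts_node_append rfl]
    exact ⟨⟨(listProd_singleton a).symm, coe_prodFrom b l⟩, rfl, ih b⟩

/-- A right comb with at least two leaves accepts only one word. (The tree without vertex accepts
all the words of length one.) -/
theorem eq_of_accepts_rightComb {a b : Ω} {l w : List Ω} (h : Accepts (rightComb a (b :: l)) w) :
    w = a :: b :: l := by
  induction l generalizing a b w with
  | nil =>
    obtain ⟨c, d, rfl⟩ := List.length_eq_two.1 h.length_eq
    rw [rightComb, ← List.singleton_append, accepts_node_append rfl] at h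
    simpa [prodFrom, semigroupProd, eq_comm] using h.1
  | cons b' l ih =>
    rw [rightComb] at h
    obtain ⟨c, w, rfl⟩ : ∃ c w', w = c :: w' := List.exists_cons_of_ne_nil (by
      rintro rfl
      exact absurd h.length_eq (BinaryTree.numLeaves_pos _).ne)
    rw [← List.singleton_append (x := c), accepts_node_append rfl] at h
    obtain ⟨⟨h₁, -⟩, -, h₂⟩ := h
    have hc : a = c := WithOne.coe_injective (h₁.trans (listProd_singleton c))
    rw [ih h₂, hc]

variable (K : Type u) [Field K] [Fintype Ω]

variable (Ω) in
/-- The operadic ideal generated by the relations of the Koszul dual. -/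
def dualIdeal : (freeOperad K (Ω × Ω)).OperadIdeal :=
  (freeOperad K (Ω × Ω)).idealSpan
    ((twoParameterAs K Ω).koszulDual.rel : Set ((freeOperad K (Ω × Ω)).obj 3))

variable {K}

theorem mem_dualIdeal {f : (freeOperad K (Ω × Ω)).obj 3}
    (h : f ∈ (twoParameterAs K Ω).koszulDual.rel) : f ∈ (dualIdeal Ω K).carrier 3 :=
  (Submodule.mem_iInf _).2 fun J => J.2 h

theorem dualIdeal_le {J : (freeOperad K (Ω × Ω)).OperadIdeal}
    (h : ((twoParameterAs K Ω).koszulDual.rel : Set ((freeOperad K (Ω × Ω)).obj 3)) ⊆ J.carrier 3)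
    (n : ℕ) : (dualIdeal Ω K).carrier n ≤ J.carrier n :=
  iInf_le (fun J : {J : (freeOperad K (Ω × Ω)).OperadIdeal //
    ((twoParameterAs K Ω).koszulDual.rel : Set ((freeOperad K (Ω × Ω)).obj 3)) ⊆ J.carrier 3} =>
      J.1.carrier n) ⟨J, h⟩

theorem treeMem_node_node_left {x y : Ω × Ω} (h : x.1 ≠ y.1 * y.2)
    (t₁ t₂ t₃ : BinaryTree (Ω × Ω)) :
    TreeMem (dualIdeal Ω K) (.node x (.node y t₁ t₂) t₃) :=
  TreeMem.graft_left (mem_dualIdeal (circOne_mem_koszulDual_rel h)) ![t₁, t₂, t₃]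

theorem treeMem_node_node_right {x y : Ω × Ω} (h : x.2 ≠ y.1 * y.2)
    (t₁ t₂ t₃ : BinaryTree (Ω × Ω)) :
    TreeMem (dualIdeal Ω K) (.node x t₁ (.node y t₂ t₃)) :=
  TreeMem.graft_left (mem_dualIdeal (circTwo_mem_koszulDual_rel h)) ![t₁, t₂, t₃]

theorem treeCongr_node_node (α β γ : Ω) (t₁ t₂ t₃ : BinaryTree (Ω × Ω)) :
    TreeCongr (dualIdeal Ω K) (.node (α * β, γ) (.node (α, β) t₁ t₂) t₃)
      (.node (α, β * γ) t₁ (.node (β, γ) t₂ t₃)) :=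
  TreeCongr.graft_left (mem_dualIdeal (leftTree_sub_rightTree_mem_koszulDual_rel α β γ))
    ![t₁, t₂, t₃]

/-- Two right combs grafted on a compatible vertex can be straightened to a right comb. -/
theorem treeCongr_node_rightComb (a c : Ω) (l m : List Ω) :
    TreeCongr (dualIdeal Ω K)
      (.node (prodFrom a l, prodFrom c m) (rightComb a l) (rightComb c m))
      (rightComb a (l ++ c :: m)) := by
  induction l generalizing a with
  | nil => exact TreeCongr.refl _
  | cons b l ih =>
    rw [rightComb, prodFrom_cons]
    refine (treeCongr_node_node _ _ _ _ _ _).trans ?_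
    rw [List.cons_append, rightComb, prodFrom_append_cons]
    exact TreeCongr.node _ (TreeCongr.refl _) (ih b)

/-- Modulo the relations, a tree with at least one vertex is zero or a right comb. -/
theorem treeMem_or_treeCongr_rightComb (t : BinaryTree (Ω × Ω)) :
    t = .nil ∨ TreeMem (dualIdeal Ω K) t ∨
      ∃ a b l, TreeCongr (dualIdeal Ω K) t (rightComb a (b :: l)) := by
  induction t with
  | nil => exact Or.inl rfl
  | node x l r hl hr =>
    refine Or.inr ?_
    have left : TreeMem (dualIdeal Ω K) (.node x l r) ∨
        ∃ a m, prodFrom a m = x.1 ∧ TreeCongr (dualIdeal Ω K) l (rightComb a m) := by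
      rcases hl with rfl | hl | ⟨a, b, m, hl⟩
      -- A leaf carries any letter, here the one imposed by the vertex.
      · exact Or.inr ⟨x.1, [], rfl, TreeCongr.refl _⟩
      · exact Or.inl (TreeMem.node_left x hl r)
      · by_cases h : prodFrom a (b :: m) = x.1
        · exact Or.inr ⟨a, b :: m, h, hl⟩
        · refine Or.inl ((TreeCongr.node x hl (TreeCongr.refl r)).treeMem ?_)
          rw [prodFrom_cons] at h
          exact treeMem_node_node_left (Ne.symm h) _ _ _
    have right : TreeMem (dualIdeal Ω K) (.node x l r) ∨
        ∃ c m, prodFrom c m = x.2 ∧ TreeCongr (dualIdeal Ω K) r (rightComb c m) := by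
      rcases hr with rfl | hr | ⟨a, b, m, hr⟩
      · exact Or.inr ⟨x.2, [], rfl, TreeCongr.refl _⟩
      · exact Or.inl (TreeMem.node_right x l hr)
      · by_cases h : prodFrom a (b :: m) = x.2
        · exact Or.inr ⟨a, b :: m, h, hr⟩
        · refine Or.inl ((TreeCongr.node x (TreeCongr.refl l) hr).treeMem ?_)
          rw [prodFrom_cons] at h
          exact treeMem_node_node_right (Ne.symm h) _ _ _
    rcases left with h | ⟨a, m, ha, hl⟩
    · exact Or.inl h
    rcases right with h | ⟨c, m', hc, hr⟩
    · exact Or.inl h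
    right
    have h := (TreeCongr.node x hl hr).trans
      (by
        rw [show x = (prodFrom a m, prodFrom c m') from Prod.ext ha.symm hc.symm]
        exact treeCongr_node_rightComb a c m m')
    rcases m with _ | ⟨b, m⟩
    · exact ⟨a, c, m', h⟩
    · exact ⟨a, b, _, h⟩

end RightComb

/-! ### Kernel and image of the morphism from trees to words -/

section Kernel

variable {K : Type u} [Field K] {Ω : Type v} [Semigroup Ω]

/-- The right comb attached to a word, with its number of leaves. -/
def wordComb {n : ℕ} (w : OmegaWord Ω n) : PlanarTree (Ω × Ω) n :=
  ⟨rightComb (w.1.head w.2.2) w.1.tail, by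
    rw [numLeaves_rightComb, ← List.length_cons (a := w.1.head w.2.2), List.cons_head_tail, w.2.1]⟩

theorem accepts_wordComb {n : ℕ} (hn : 2 ≤ n) (w w' : OmegaWord Ω n) :
    Accepts (wordComb w).1 w'.1 ↔ w = w' := by
  obtain ⟨l, rfl, hl⟩ := w
  rcases l with _ | ⟨a, _ | ⟨b, l⟩⟩
  · exact absurd rfl hl
  · simp at hn
  · refine ⟨fun h => Subtype.ext (eq_of_accepts_rightComb h).symm, ?_⟩
    rintro rfl
    exact accepts_rightComb_self _ _

variable [Fintype Ω]

theorem mem_or_sub_wordComb_mem {n : ℕ} (hn : 2 ≤ n) (t : PlanarTree (Ω × Ω) n) :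
    treeElement K t ∈ (dualIdeal Ω K).carrier n ∨ ∃ w : OmegaWord Ω n,
      treeElement K t - treeElement K (wordComb w) ∈ (dualIdeal Ω K).carrier n := by
  rcases treeMem_or_treeCongr_rightComb (K := K) t.1 with h | h | ⟨a, b, l, h⟩
  · have := t.2
    rw [h, BinaryTree.numLeaves] at this
    omega
  · exact Or.inl ((treeMem_iff t).1 h)
  · refine Or.inr ⟨⟨a :: b :: l, ?_, List.cons_ne_nil _ _⟩, (treeCongr_iff t _).1 h⟩
    rw [← t.2, h.1, numLeaves_rightComb]
    rfl

variable [DecidableEq Ω]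

theorem treeEval_wordComb {n : ℕ} (hn : 2 ≤ n) (w : OmegaWord Ω n) :
    treeEval K n (treeElement K (wordComb w)) = wordElement K w := by
  classical
  refine wordOperad_ext fun w' => ?_
  rw [wordCoeff_treeEval, wordCoeff_wordElement]
  exact if_congr (accepts_wordComb hn w w') rfl rfl

variable (K Ω) in
theorem dualIdeal_le_ker (n : ℕ) :
    (dualIdeal Ω K).carrier n ≤ (treeEvalHom K Ω).ker.carrier n :=
  dualIdeal_le koszulDual_rel_le_ker n

theorem treeEval_eq_zero_of_mem {n : ℕ} {f : (freeOperadData K (Ω × Ω)).obj n}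
    (h : f ∈ (dualIdeal Ω K).carrier n) : treeEval K n f = 0 :=
  dualIdeal_le_ker K Ω n h

variable (K Ω) in
/-- The component of arity `n` of the ideal of relations, as a subspace of the space with basis the
trees with `n` leaves. -/
def dualSubmodule (n : ℕ) : Submodule K ((freeOperadData K (Ω × Ω)).obj n) :=
  (dualIdeal Ω K).carrier n

variable (K Ω) in
/-- The linear map sending a word to the class of its right comb. -/
def combClass (n : ℕ) : (wordOperadData K Ω).obj n →ₗ[K]
    (freeOperadData K (Ω × Ω)).obj n ⧸ dualSubmodule K Ω n :=
  (wordBasis K Ω n).constr K fun w => (dualSubmodule K Ω n).mkQ (treeElement K (wordComb w))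

theorem combClass_wordElement {n : ℕ} (w : OmegaWord Ω n) :
    combClass K Ω n (wordElement K w) = (dualSubmodule K Ω n).mkQ (treeElement K (wordComb w)) := by
  rw [← wordBasis_apply, combClass, Module.Basis.constr_basis]

/-- In arity at least two, the class of an element of the free operad can be recovered from its
image in the operad of words. -/
theorem combClass_treeEval {n : ℕ} (hn : 2 ≤ n) (f : (freeOperadData K (Ω × Ω)).obj n) :
    combClass K Ω n (treeEval K n f) = (dualSubmodule K Ω n).mkQ f := by
  have key : combClass K Ω n ∘ₗ treeEval K n = (dualSubmodule K Ω n).mkQ := by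
    refine (treeBasis K (Ω × Ω) n).ext fun t => ?_
    rw [treeBasis_apply, LinearMap.comp_apply]
    rcases mem_or_sub_wordComb_mem (K := K) hn t with h | ⟨w, h⟩
    · rw [treeEval_eq_zero_of_mem h, map_zero]
      exact ((Submodule.Quotient.mk_eq_zero _).2 h).symm
    · have e := treeEval_eq_zero_of_mem h
      rw [map_sub, sub_eq_zero, treeEval_wordComb hn] at e
      rw [e, combClass_wordElement]
      exact ((Submodule.Quotient.eq _).2 h).symm
  exact congrArg (fun g : _ →ₗ[K] _ => g f) key

theorem wordOperad_one_ne_zero [Nonempty Ω] : (wordOperadData K Ω).one ≠ 0 := by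
  intro h
  obtain ⟨α⟩ := ‹Nonempty Ω›
  have := wordCoeff_one (K := K) (⟨[α], rfl, List.cons_ne_nil _ _⟩ : OmegaWord Ω 1)
  rw [h, map_zero] at this
  exact zero_ne_one this

theorem exists_smul_emptyTree {X : Type v} (f : (freeOperadData K X).obj 1) :
    ∃ r : K, r • treeElement K (emptyTree X) = f := by
  have : Subsingleton (PlanarTree X 1) := ⟨fun s t => Subtype.ext
    ((BinaryTree.eq_nil_of_numLeaves_le_one s.2.le).trans
      (BinaryTree.eq_nil_of_numLeaves_le_one t.2.le).symm)⟩
  refine ⟨(treeBasis K X 1).repr f (emptyTree X), (treeBasis K X 1).repr.injective ?_⟩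
  ext t
  obtain rfl := Subsingleton.elim t (emptyTree X)
  rw [map_smul, ← treeBasis_apply, Module.Basis.repr_self]
  simp

theorem dualIdeal_eq_ker [Nonempty Ω] (n : ℕ) :
    (dualIdeal Ω K).carrier n = (treeEvalHom K Ω).ker.carrier n := by
  refine le_antisymm (dualIdeal_le_ker K Ω n) ?_
  intro f hf
  replace hf : treeEval K (Ω := Ω) n f = 0 := hf
  rcases Nat.lt_or_ge n 2 with hn | hn
  · suffices h : f = 0 by
      rw [h]
      exact Submodule.zero_mem _
    interval_cases n
    · refine (treeBasis K (Ω × Ω) 0).repr.injective (Finsupp.ext fun t => ?_)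
      exact absurd rfl (planarTree_arity_ne_zero t)
    · obtain ⟨r, rfl⟩ := exists_smul_emptyTree f
      rw [map_smul, treeEval_emptyTree] at hf
      rw [(smul_eq_zero.1 hf).resolve_right wordOperad_one_ne_zero]
      exact zero_smul K _
  · have := combClass_treeEval hn f
    rw [hf, map_zero] at this
    exact (Submodule.Quotient.mk_eq_zero _).1 this.symm

theorem range_treeEval (n : ℕ) :
    LinearMap.range (treeEval K n) = wordSuboperadCarrier K Ω n := by
  rcases n with _ | _ | n
  · refine LinearMap.range_eq_top.2 fun x => ⟨0, wordOperad_ext fun w => ?_⟩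
    exact isEmptyElim w
  · refine le_antisymm ?_ ?_
    · rintro _ ⟨f, rfl⟩
      obtain ⟨r, rfl⟩ := exists_smul_emptyTree f
      rw [map_smul, treeEval_emptyTree]
      exact Submodule.smul_mem _ _ (Submodule.mem_span_singleton_self _)
    · exact (Submodule.span_singleton_le_iff_mem _ _).2 ⟨_, treeEval_emptyTree⟩
  · refine eq_top_iff.2 ?_
    rw [← (wordBasis K Ω (n + 2)).span_eq, Submodule.span_le]
    rintro _ ⟨w, rfl⟩
    exact ⟨treeElement K (wordComb w), by
      rw [treeEval_wordComb (Nat.le_add_left 2 n), wordBasis_apply]⟩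

theorem finrank_wordSuboperadCarrier_one [Nonempty Ω] :
    Module.finrank K (wordSuboperadCarrier K Ω 1) = 1 :=
  finrank_span_singleton wordOperad_one_ne_zero

theorem finrank_wordSuboperadCarrier {n : ℕ} (hn : 2 ≤ n) :
    Module.finrank K (wordSuboperadCarrier K Ω n) = Fintype.card Ω ^ n := by
  have h : wordSuboperadCarrier K Ω n = ⊤ := by
    obtain ⟨n, rfl⟩ := Nat.exists_eq_add_of_le' hn
    rfl
  rw [h, finrank_top, Module.finrank_eq_nat_card_basis (wordBasis K Ω n),
    Nat.card_congr (OmegaWord.letterEquiv (by omega))]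
  simp

end Kernel

end
theorem proposition1p7 (K : Type u) [Field K] (Ω : Type v) [Semigroup Ω] [Fintype Ω]
    [DecidableEq Ω] [Nonempty Ω] :
    ∃ hP : (wordOperadData K Ω).IsOperad,
      (wordOperadData K Ω).one =
        ∑ α : Ω, wordElement K (⟨[α], rfl, List.cons_ne_nil _ _⟩ : OmegaWord Ω 1) ∧
      (∀ {n : ℕ} (hn : n ≠ 0) (k : Fin n → ℕ) (a : OmegaWord Ω n) (w : ∀ i, OmegaWord Ω (k i)),
        (wordOperadData K Ω).comp k (wordElement K a) (fun i => wordElement K (w i)) =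
          (∏ i, if a.letter i = (w i).value then (1 : K) else 0) •
            wordElement K (OmegaWord.concat hn k w)) ∧
      (∃ P₀ : NSOperad.Suboperad ⟨wordOperadData K Ω, hP⟩,
        (∀ n, P₀.carrier n = wordSuboperadCarrier K Ω n) ∧
        Nonempty (NSOperad.Iso (twoParameterAs K Ω).koszulDual.operad P₀.toNSOperad)) ∧
      Module.finrank K ((twoParameterAs K Ω).koszulDual.operad.obj 1) = 1 ∧
      ∀ n, 2 ≤ n →
        Module.finrank K ((twoParameterAs K Ω).koszulDual.operad.obj n) = Fintype.card Ω ^ n := by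
  let e : NSOperad.Iso (twoParameterAs K Ω).koszulDual.operad
      (treeEvalHom K Ω).range.toNSOperad :=
    (treeEvalHom K Ω).quotientIsoRange (dualIdeal Ω K) dualIdeal_eq_ker
  have hdim : ∀ n, Module.finrank K ((twoParameterAs K Ω).koszulDual.operad.obj n) =
      Module.finrank K (wordSuboperadCarrier K Ω n) := by
    intro n
    rw [← range_treeEval]
    exact (e.equiv n).finrank_eq
  exact ⟨wordOperadData_isOperad, rfl, wordOperadData_comp_wordElement,
    ⟨(treeEvalHom K Ω).range, range_treeEval, ⟨e⟩⟩,
    (hdim 1).trans finrank_wordSuboperadCarrier_one,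
    fun n hn => (hdim n).trans (finrank_wordSuboperadCarrier hn)⟩
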